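/- **Theorem 5.2 (normalized potentials of a timelike CMC surface).** Identify Minkowski 3-space $\mathbb E^3_1$ with $\mathfrak{sl}(2,\mathbb R)$, with scalar product $\langle X,Y\rangle=\tfrac12\operatorname{tr}(XY)$, and put $$\mathbf i=\begin{pmatrix}0&-1\\1&0\end{pmatrix},\quad \mathbf j'=\begin{pmatrix}0&1\\1&0\end{pmatrix},\quad \mathbf k'=\begin{pmatrix}-1&0\\0&1\end{pmatrix},\quad \sigma=\mathrm{Ad}(\mathbf k').$$ Let $D\subset\mathbb R^2$ be an open set containing the origin and let $\varphi:D\to\mathbb E^3_1$ be a smooth timelike surface with smooth unit normal field $N$ and constant mean curvature $H$, such that $(x,y)$ are null coordinates with induced metric $e^{\omega}\,dx\,dy$. Let $\langle\varphi_{xx},N\rangle\,dx^2$ and $\langle\varphi_{yy},N\rangle\,dy^2$ be its Hopf differentials, and put $Q(x)=\langle\varphi_{xx},N\rangle(x,0)$, $R(y)=\langle\varphi_{yy},N\rangle(0,y)$. *Extended framing.* Let $F:D\to\mathrm{SL}(2,\mathbb R)$ be a smooth coordinate frame of $\varphi$, i.e. $\mathrm{Ad}(F)$ maps $(\mathbf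 i,\mathbf j',\mathbf k')$ to $$\bigl(e^{-\omega/2}(-\varphi_x+\varphi_y),\ e^{-\omega/2}(\varphi_x+\varphi_y),\ N\bigr),$$ possibly after applying one fixed linear isometry of $\mathbb E^3_1$ to the latter frame. Write $F^{-1}dF=\alpha_0+\alpha_1'\,dx+\alpha_1''\,dy$, where $\alpha_0$ is the diagonal part and $\alpha_1',\alpha_1''$ are off-diagonal. Let $\tilde\Lambda G_\sigma$ be the group of analytic loops $\gamma:\mathbb C^*\to \mathrm{SL}(2,\mathbb C)$ with real Laurent coefficients and $\sigma(\gamma(\lambda))=\gamma(-\lambda)$. Let $\Phi:D\to\tilde\Lambda G_\sigma$ be the extended framing: $$\Phi^{-1}d\Phi=\alpha_0+\lambda\,\alpha_1'\,dx+\lambda^{-1}\alpha_1''\,dy,\qquad \Phi(0,0;\lambda)=\mathbf 1 .$$ *Normalized potentials.* For an open neighbourhood $\Omega\subset D$ of the origin on which $\Phi=\Phi_+L_-$ with $\Phi_+,L_-$ valued in $\tilde\Lambda G_\sigma$, $\Phi_+=\mathbf 1+\sum_{k\ge1}(\Phi_+)_k\lambda^k$ and $L_-=\sum_{k\le0}(L_-)_k\lambda^k$,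 the $(1,0)$-potential is $\xi'=\Phi_+^{-1}d\Phi_+$. If instead $\Phi=\Phi_-L_+$ on $\Omega$, with $\Phi_-=\mathbf 1+\sum_{k\le-1}(\Phi_-)_k\lambda^k$ and $L_+=\sum_{k\ge0}(L_+)_k\lambda^k$, the $(0,1)$-potential is $\xi''=\Phi_-^{-1}d\Phi_-$. Let $D'$ be the set of points $(x,y)$ such that the segments from $(0,0)$ to $(x,0)$ and from $(x,0)$ to $(x,y)$ lie in $D$, and $D''$ the set of points $(x,y)$ such that the segments from $(0,0)$ to $(0,y)$ and from $(0,y)$ to $(x,y)$ lie in $D$. (If $D$ is a product of two intervals, $D'=D''=D$.) Then $D'$ and $D''$ are open neighbourhoods of the origin, $\langle\varphi_{xx},N\rangle(x,y)=Q(x)$ on $D'$ and $\langle\varphi_{yy},N\rangle(x,y)=R(y)$ on $D''$. The decomposition $\Phi=\Phi_+L_-$ exists on $D'$, the decomposition $\Phi=\Phi_-L_+$ exists on $D''$, and the normalized potentials based at the origin are $$\xi'=\lambda\begin{pmatrix}0&-\frac H2 f(x)\\ Q(x)/f(x)&0\end{pmatrix}dx\ \text{ on } D',\qquad \xi''=\lambda^{-1}\begin{pmatrix}0&-R(y)/g(y)\\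 \frac H2 g(y)&0\end{pmatrix}dy\ \text{ on } D'',$$ where $$f(x)=\exp\{\omega(x,0)-\omega(0,0)/2\},\qquad g(y)=\exp\{\omega(0,y)-\omega(0,0)/2\}.$$ -/

import Mathlib

noncomputable section

namespace TimelikeCMC

/-- Two by two matrices. -/
abbrev M2 (R : Type) : Type := Matrix (Fin 2) (Fin 2) R

/-! ### Minkowski 3-space as the Lie algebra of trace-free real matrices -/

/-- The timelike basis vector `i`. -/
def bi : M2 ℝ := !![0, -1; 1, 0]

/-- The spacelike basis vector `j'`. -/
def bj : M2 ℝ := !![0, 1; 1, 0]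

/-- The spacelike basis vector `k'`. -/
def bk : M2 ℝ := !![-1, 0; 0, 1]

/-- The scalar product `⟨X, Y⟩ = tr (X Y) / 2`. On trace-free matrices it is the Lorentz metric. -/
def mink (X Y : M2 ℝ) : ℝ := (1 / 2) * (X * Y).trace

theorem mink_basis (u v : Fin 3 → ℝ) :
    mink (u 0 • bi + u 1 • bj + u 2 • bk) (v 0 • bi + v 1 • bj + v 2 • bk)
      = -(u 0 * v 0) + u 1 * v 1 + u 2 * v 2 := by
  simp [mink, bi, bj, bk, Matrix.trace_fin_two]
  ring

/-- A linear isometry of Minkowski 3-space, that is, an element of the full Lorentz group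
`O_1(3)`: only the values of `A` on trace-free matrices matter. -/
structure IsLorentzIsometry (A : M2 ℝ →ₗ[ℝ] M2 ℝ) : Prop where
  trace_zero : ∀ X, X.trace = 0 → (A X).trace = 0
  isometry : ∀ X Y, X.trace = 0 → Y.trace = 0 → mink (A X) (A Y) = mink X Y

/-! ### Calculus of matrix-valued maps of two real variables, entry by entry -/

/-- Smoothness on a set. -/
def SmoothOn (D : Set (ℝ × ℝ)) (F : ℝ × ℝ → M2 ℝ) : Prop :=
  ∀ i j, ContDiffOn ℝ ((⊤ : ℕ∞) : WithTop ℕ∞) (fun p => F p i j) D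

/-- The partial derivative with respect to `x`. -/
def pdx (F : ℝ × ℝ → M2 ℝ) (p : ℝ × ℝ) : M2 ℝ :=
  Matrix.of fun i j => deriv (fun t => F (t, p.2) i j) p.1

/-- The partial derivative with respect to `y`. -/
def pdy (F : ℝ × ℝ → M2 ℝ) (p : ℝ × ℝ) : M2 ℝ :=
  Matrix.of fun i j => deriv (fun t => F (p.1, t) i j) p.2

/-- `F⁻¹ dF = A dx + B dy` at the point `p`: the map `F` is differentiable at `p`, with
differential `(F p * A) dx + (F p * B) dy`. -/
def HasMCForm (F : ℝ × ℝ → M2 ℂ) (A B : M2 ℂ) (p : ℝ × ℝ) : Prop :=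
  ∀ i j, HasFDerivAt (fun q => F q i j)
    ((ContinuousLinearMap.fst ℝ ℝ ℝ).smulRight ((F p * A) i j) +
      (ContinuousLinearMap.snd ℝ ℝ ℝ).smulRight ((F p * B) i j)) p

/-! ### Timelike surfaces in null coordinates -/

/-- The matrix of the first fundamental form in the coordinates `(x, y)`. -/
def firstForm (φ : ℝ × ℝ → M2 ℝ) (p : ℝ × ℝ) : M2 ℝ :=
  !![mink (pdx φ p) (pdx φ p), mink (pdx φ p) (pdy φ p);
     mink (pdy φ p) (pdx φ p), mink (pdy φ p) (pdy φ p)]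

/-- The matrix of the second fundamental form `II = -⟨dφ, dN⟩`. -/
def secondForm (φ N : ℝ × ℝ → M2 ℝ) (p : ℝ × ℝ) : M2 ℝ :=
  !![-mink (pdx φ p) (pdx N p), -mink (pdx φ p) (pdy N p);
     -mink (pdy φ p) (pdx N p), -mink (pdy φ p) (pdy N p)]

/-- The mean curvature `H = tr (II I⁻¹) / 2`. -/
def meanCurvature (φ N : ℝ × ℝ → M2 ℝ) (p : ℝ × ℝ) : ℝ :=
  (1 / 2) * (secondForm φ N p * (firstForm φ p)⁻¹).trace

/-- The coefficient `Q = ⟨φ_xx, N⟩` of the Hopf differential `Q dx²`. -/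
def hopfQ (φ N : ℝ × ℝ → M2 ℝ) (p : ℝ × ℝ) : ℝ := mink (pdx (pdx φ) p) (N p)

/-- The coefficient `R = ⟨φ_yy, N⟩` of the Hopf differential `R dy²`. -/
def hopfR (φ N : ℝ × ℝ → M2 ℝ) (p : ℝ × ℝ) : ℝ := mink (pdy (pdy φ) p) (N p)

/-- `φ : D → 𝔼³₁` is a timelike surface with unit normal field `N` and constant mean curvature
`H`, and `(x, y)` are null coordinates in which its metric is `e^ω dx dy`. -/
structure IsTimelikeCMCSurface (D : Set (ℝ × ℝ)) (φ N : ℝ × ℝ → M2 ℝ) (ω : ℝ × ℝ → ℝ)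
    (H : ℝ) : Prop where
  smooth : SmoothOn D φ
  smooth_normal : SmoothOn D N
  trace_zero : ∀ p ∈ D, (φ p).trace = 0
  trace_zero_normal : ∀ p ∈ D, (N p).trace = 0
  /-- The metric `e^ω dx dy` pairs `∂_x` with `∂_y` to `e^ω / 2`. -/
  metric : ∀ p ∈ D, firstForm φ p = !![0, Real.exp (ω p) / 2; Real.exp (ω p) / 2, 0]
  normal_unit : ∀ p ∈ D, mink (N p) (N p) = 1
  normal_x : ∀ p ∈ D, mink (pdx φ p) (N p) = 0
  normal_y : ∀ p ∈ D, mink (pdy φ p) (N p) = 0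
  mean : ∀ p ∈ D, meanCurvature φ N p = H

/-- A coordinate frame of the surface: a smooth lift `F : D → SL(2, ℝ)` through `Ad` of the
orthonormal frame `(e^{-ω/2}(-φ_x + φ_y), e^{-ω/2}(φ_x + φ_y), N)`. A lift exists only if the
orthonormal frame lies in the identity component of the Lorentz group; since every surface is
brought to this position by a Lorentz isometry `A`, such an `A` is allowed for. -/
structure IsCoordinateFrame (D : Set (ℝ × ℝ)) (φ N : ℝ × ℝ → M2 ℝ) (ω : ℝ × ℝ → ℝ)
    (A : M2 ℝ →ₗ[ℝ] M2 ℝ) (F : ℝ × ℝ → M2 ℝ) : Prop where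
  smooth : SmoothOn D F
  det_one : ∀ p ∈ D, (F p).det = 1
  ad_i : ∀ p ∈ D,
    F p * bi * (F p)⁻¹ = A (Real.exp (-ω p / 2) • (-pdx φ p + pdy φ p))
  ad_j : ∀ p ∈ D,
    F p * bj * (F p)⁻¹ = A (Real.exp (-ω p / 2) • (pdx φ p + pdy φ p))
  ad_k : ∀ p ∈ D, F p * bk * (F p)⁻¹ = A (N p)

/-! ### Twisted loops -/

/-- The inclusion of real into complex matrices. -/
def toC (X : M2 ℝ) : M2 ℂ := X.map Complex.ofReal

/-- The involution `σ = Ad k'`, on complex matrices. -/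
def sigma (X : M2 ℂ) : M2 ℂ := toC bk * X * (toC bk)⁻¹

/-- The projection to the fixed space of `σ` (for real matrices: to `𝔨 = ℝ k'`). -/
def kPart (X : M2 ℂ) : M2 ℂ := (1 / 2 : ℂ) • (X + sigma X)

/-- The projection to the `(-1)`-eigenspace of `σ` (for real matrices: to `𝔪 = ℝ i ⊕ ℝ j'`). -/
def mPart (X : M2 ℂ) : M2 ℂ := (1 / 2 : ℂ) • (X - sigma X)

/-- The twisted analytic loop group of `SL(2, ℝ)`: loops that extend analytically to `ℂ^*`, with
real Laurent coefficients, determinant one and `σ(γ(λ)) = γ(-λ)`. The value at `0` is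
irrelevant. -/
structure IsTwistedLoop (γ : ℂ → M2 ℂ) : Prop where
  analytic : ∀ i j, DifferentiableOn ℂ (fun l => γ l i j) {0}ᶜ
  det_one : ∀ l, l ≠ 0 → (γ l).det = 1
  real_coeff : ∀ l, l ≠ 0 → ∀ i j, γ (starRingEnd ℂ l) i j = starRingEnd ℂ (γ l i j)
  twisted : ∀ l, l ≠ 0 → sigma (γ l) = γ (-l)

/-- Twisted loops `∑_{k ≥ 0} γ_k λ^k`. -/
def IsPlusLoop (γ : ℂ → M2 ℂ) : Prop :=
  IsTwistedLoop γ ∧ ∃ h : ℂ → M2 ℂ,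
    (∀ i j, Differentiable ℂ (fun l => h l i j)) ∧ ∀ l, l ≠ 0 → γ l = h l

/-- Twisted loops `1 + ∑_{k ≥ 1} γ_k λ^k`. -/
def IsPlusStarLoop (γ : ℂ → M2 ℂ) : Prop :=
  IsTwistedLoop γ ∧ ∃ h : ℂ → M2 ℂ,
    (∀ i j, Differentiable ℂ (fun l => h l i j)) ∧ h 0 = 1 ∧ ∀ l, l ≠ 0 → γ l = h l

/-- Twisted loops `∑_{k ≤ 0} γ_k λ^k`. -/
def IsMinusLoop (γ : ℂ → M2 ℂ) : Prop :=
  IsTwistedLoop γ ∧ ∃ h : ℂ → M2 ℂ,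
    (∀ i j, Differentiable ℂ (fun l => h l i j)) ∧ ∀ l, l ≠ 0 → γ l = h l⁻¹

/-- Twisted loops `1 + ∑_{k ≤ -1} γ_k λ^k`. -/
def IsMinusStarLoop (γ : ℂ → M2 ℂ) : Prop :=
  IsTwistedLoop γ ∧ ∃ h : ℂ → M2 ℂ,
    (∀ i j, Differentiable ℂ (fun l => h l i j)) ∧ h 0 = 1 ∧ ∀ l, l ≠ 0 → γ l = h l⁻¹

/-- The Birkhoff decomposition `γ = γ₊ ℓ₋`. -/
def IsBirkhoffPM (γ γp lm : ℂ → M2 ℂ) : Prop :=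
  IsPlusStarLoop γp ∧ IsMinusLoop lm ∧ ∀ l, l ≠ 0 → γ l = γp l * lm l

/-- The Birkhoff decomposition `γ = γ₋ ℓ₊`. -/
def IsBirkhoffMP (γ γm lp : ℂ → M2 ℂ) : Prop :=
  IsMinusStarLoop γm ∧ IsPlusLoop lp ∧ ∀ l, l ≠ 0 → γ l = γm l * lp l

/-! ### Extended framings and normalized potentials -/

/-- The extended framing that belongs to a framing `F`: with `α = F⁻¹ dF = U dx + V dy`, the map
`Φ` into the twisted loop group is normalized by `Φ(0, 0; λ) = 1` and satisfies
`Φ⁻¹ dΦ = α_0 + λ α_1' + λ⁻¹ α_1''`. -/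
structure IsExtendedFraming (D : Set (ℝ × ℝ)) (F : ℝ × ℝ → M2 ℝ)
    (Φ : ℝ × ℝ → ℂ → M2 ℂ) : Prop where
  loop : ∀ p ∈ D, IsTwistedLoop (Φ p)
  base : ∀ l, l ≠ 0 → Φ 0 l = 1
  form : ∀ p ∈ D, ∀ l, l ≠ 0 → HasMCForm (fun q => Φ q l)
    (kPart (toC ((F p)⁻¹ * pdx F p)) + l • mPart (toC ((F p)⁻¹ * pdx F p)))
    (kPart (toC ((F p)⁻¹ * pdy F p)) + l⁻¹ • mPart (toC ((F p)⁻¹ * pdy F p))) p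

/-- `ξ(x; λ) dx` is the normalized `(1,0)`-potential of `Φ` on the open neighbourhood `Ω` of the
origin: on `Ω` the Birkhoff decomposition `Φ = Φ₊ L₋` exists, and
`Φ₊⁻¹ dΦ₊ = ξ(x; λ) dx`, with no `dy`-part. -/
structure IsNormalizedPotentialX (Ω : Set (ℝ × ℝ)) (Φ : ℝ × ℝ → ℂ → M2 ℂ)
    (ξ : ℝ → ℂ → M2 ℂ) : Prop where
  isOpen : IsOpen Ω
  zero_mem : (0 : ℝ × ℝ) ∈ Ω
  splits : ∀ p ∈ Ω, ∃ γp lm, IsBirkhoffPM (Φ p) γp lm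
  form : ∀ Φp Lm : ℝ × ℝ → ℂ → M2 ℂ, (∀ p ∈ Ω, IsBirkhoffPM (Φ p) (Φp p) (Lm p)) →
    ∀ p ∈ Ω, ∀ l, l ≠ 0 → HasMCForm (fun q => Φp q l) (ξ p.1 l) 0 p

/-- `ξ(y; λ) dy` is the normalized `(0,1)`-potential of `Φ` on the open neighbourhood `Ω` of the
origin: on `Ω` the Birkhoff decomposition `Φ = Φ₋ L₊` exists, and
`Φ₋⁻¹ dΦ₋ = ξ(y; λ) dy`, with no `dx`-part. -/
structure IsNormalizedPotentialY (Ω : Set (ℝ × ℝ)) (Φ : ℝ × ℝ → ℂ → M2 ℂ)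
    (ξ : ℝ → ℂ → M2 ℂ) : Prop where
  isOpen : IsOpen Ω
  zero_mem : (0 : ℝ × ℝ) ∈ Ω
  splits : ∀ p ∈ Ω, ∃ γm lp, IsBirkhoffMP (Φ p) γm lp
  form : ∀ Φm Lp : ℝ × ℝ → ℂ → M2 ℂ, (∀ p ∈ Ω, IsBirkhoffMP (Φ p) (Φm p) (Lp p)) →
    ∀ p ∈ Ω, ∀ l, l ≠ 0 → HasMCForm (fun q => Φm q l) 0 (ξ p.2 l) p

/-- The points `(x, y)` for which the path from `(0, 0)` along the null line to `(x, 0)` and from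
there along the null line to `(x, y)` stays in `D`. It is all of `D` if `D` is a product of two
intervals containing `0`. -/
def hookX (D : Set (ℝ × ℝ)) : Set (ℝ × ℝ) :=
  {p | (∀ t ∈ Set.uIcc 0 p.1, (t, (0 : ℝ)) ∈ D) ∧ ∀ s ∈ Set.uIcc 0 p.2, (p.1, s) ∈ D}

/-- The points `(x, y)` for which the path from `(0, 0)` along the null line to `(0, y)` and from
there along the null line to `(x, y)` stays in `D`. -/
def hookY (D : Set (ℝ × ℝ)) : Set (ℝ × ℝ) :=
  {p | (∀ s ∈ Set.uIcc 0 p.2, ((0 : ℝ), s) ∈ D) ∧ ∀ t ∈ Set.uIcc 0 p.1, (t, p.2) ∈ D}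

end TimelikeCMC

end

noncomputable section

namespace TimelikeCMC

open Set Filter Topology

/-! ### Partial derivatives of smooth matrix-valued maps -/

section Calculus

variable {D : Set (ℝ × ℝ)} {F G : ℝ × ℝ → M2 ℝ} {g : ℝ × ℝ → ℝ} {p : ℝ × ℝ}

/-! The proof computes the Maurer-Cartan form of the frame and then splits the extended framing
explicitly along null lines.

Since j' - i and j' + i are twice the elementary nilpotents, A φ_x and A φ_y are e^{ω/2} times
conjugates by F of E₁₂ and E₂₁. Differentiating again expresses the second derivatives of φ through
F⁻¹F_x and F⁻¹F_y. Pairing with N, which corresponds to k', gives the entries with Q, R and H;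
equality of the mixed derivatives gives the diagonals ω_x/4 and -ω_y/4 (`frameEquations`). One
off-diagonal entry of the Maurer-Cartan equation is Q_y = 0, the other R_x = 0 (`hasDerivAt_hopfQ`,
`hasDerivAt_hopfR`).

On y = 0 the form of Φ is a diagonal term plus λ times an off-diagonal one. Right multiplication by
the diagonal matrix `boost` with exponent (ω(0,0) - ω(x,0))/4 removes the diagonal term. What
remains solves Ψ' = λΨB, so Grönwall gives Ψ → 1 as λ → 0, and the singularity at λ = 0 is
removable: this is Φ₊. On the vertical segment Φ(x,0)⁻¹Φ(x,y) is treated alike in λ⁻¹ and yields L₋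
(`isBirkhoffPM_factors`). By Liouville the splitting is unique (`IsBirkhoffPM.unique`), so Φ₊ is
this function of x alone, and ξ' is the off-diagonal part conjugated by the boost. Exchanging x with
y and λ with λ⁻¹ gives ξ''. -/

theorem hasDerivAt_prodMk_left (p : ℝ × ℝ) :
    HasDerivAt (fun t : ℝ => (t, p.2)) ((1 : ℝ), (0 : ℝ)) p.1 :=
  (hasDerivAt_id p.1).prodMk (hasDerivAt_const p.1 p.2)

theorem hasDerivAt_prodMk_right (p : ℝ × ℝ) :
    HasDerivAt (fun t : ℝ => (p.1, t)) ((0 : ℝ), (1 : ℝ)) p.2 :=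
  (hasDerivAt_const p.2 p.1).prodMk (hasDerivAt_id p.2)

theorem hasDerivAt_fst_of_differentiableAt (hg : DifferentiableAt ℝ g p) :
    HasDerivAt (fun t => g (t, p.2)) (fderiv ℝ g p (1, 0)) p.1 :=
  HasFDerivAt.comp_hasDerivAt (x := p.1) (f := fun t : ℝ => (t, p.2)) (l := g)
    hg.hasFDerivAt (hasDerivAt_prodMk_left p)

theorem hasDerivAt_snd_of_differentiableAt (hg : DifferentiableAt ℝ g p) :
    HasDerivAt (fun t => g (p.1, t)) (fderiv ℝ g p (0, 1)) p.2 :=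
  HasFDerivAt.comp_hasDerivAt (x := p.2) (f := fun t : ℝ => (p.1, t)) (l := g)
    hg.hasFDerivAt (hasDerivAt_prodMk_right p)

theorem ContDiffOn.differentiableAt_of_isOpen (hD : IsOpen D)
    (hg : ContDiffOn ℝ ((⊤ : ℕ∞) : WithTop ℕ∞) g D) (hp : p ∈ D) : DifferentiableAt ℝ g p :=
  (hg.contDiffAt (hD.mem_nhds hp)).differentiableAt (by simp)

theorem SmoothOn.hasDerivAt_x (hF : SmoothOn D F) (hD : IsOpen D) (hp : p ∈ D) (i j : Fin 2) :
    HasDerivAt (fun t => F (t, p.2) i j) (pdx F p i j) p.1 := by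
  have h := hasDerivAt_fst_of_differentiableAt
    (ContDiffOn.differentiableAt_of_isOpen hD (hF i j) hp)
  simpa [pdx] using h.differentiableAt.hasDerivAt

theorem SmoothOn.hasDerivAt_y (hF : SmoothOn D F) (hD : IsOpen D) (hp : p ∈ D) (i j : Fin 2) :
    HasDerivAt (fun t => F (p.1, t) i j) (pdy F p i j) p.2 := by
  have h := hasDerivAt_snd_of_differentiableAt
    (ContDiffOn.differentiableAt_of_isOpen hD (hF i j) hp)
  simpa [pdy] using h.differentiableAt.hasDerivAt

theorem SmoothOn.pdx_apply (hF : SmoothOn D F) (hD : IsOpen D) (hp : p ∈ D) (i j : Fin 2) :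
    pdx F p i j = fderiv ℝ (fun q => F q i j) p (1, 0) :=
  (hF.hasDerivAt_x hD hp i j).unique (hasDerivAt_fst_of_differentiableAt
    (ContDiffOn.differentiableAt_of_isOpen hD (hF i j) hp))

theorem SmoothOn.pdy_apply (hF : SmoothOn D F) (hD : IsOpen D) (hp : p ∈ D) (i j : Fin 2) :
    pdy F p i j = fderiv ℝ (fun q => F q i j) p (0, 1) :=
  (hF.hasDerivAt_y hD hp i j).unique (hasDerivAt_snd_of_differentiableAt
    (ContDiffOn.differentiableAt_of_isOpen hD (hF i j) hp))

theorem SmoothOn.pdx (hF : SmoothOn D F) (hD : IsOpen D) : SmoothOn D (pdx F) := by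
  intro i j
  have h := ((hF i j).fderiv_of_isOpen hD (m := ((⊤ : ℕ∞) : WithTop ℕ∞)) (by simp)).clm_apply
    (contDiffOn_const (c := ((1 : ℝ), (0 : ℝ))))
  exact h.congr fun q hq => hF.pdx_apply hD hq i j

theorem SmoothOn.pdy (hF : SmoothOn D F) (hD : IsOpen D) : SmoothOn D (pdy F) := by
  intro i j
  have h := ((hF i j).fderiv_of_isOpen hD (m := ((⊤ : ℕ∞) : WithTop ℕ∞)) (by simp)).clm_apply
    (contDiffOn_const (c := ((0 : ℝ), (1 : ℝ))))
  exact h.congr fun q hq => hF.pdy_apply hD hq i j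

/-- Symmetry of the mixed second partial derivatives. -/
theorem SmoothOn.pdx_pdy_comm (hF : SmoothOn D F) (hD : IsOpen D) (hp : p ∈ D) :
    TimelikeCMC.pdx (TimelikeCMC.pdy F) p = TimelikeCMC.pdy (TimelikeCMC.pdx F) p := by
  ext i j
  have hev : ∀ᶠ q in 𝓝 p, q ∈ D := hD.mem_nhds hp
  have hsm := (hF i j).contDiffAt (hD.mem_nhds hp)
  have hdd : DifferentiableAt ℝ (fderiv ℝ fun q => F q i j) p :=
    (hsm.fderiv_right (m := 1) (WithTop.coe_le_coe.2 le_top)).differentiableAt (by simp)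
  rw [(hF.pdy hD).pdx_apply hD hp, (hF.pdx hD).pdy_apply hD hp,
    Filter.EventuallyEq.fderiv_eq (hev.mono fun q hq => hF.pdy_apply hD hq i j),
    Filter.EventuallyEq.fderiv_eq (hev.mono fun q hq => hF.pdx_apply hD hq i j),
    fderiv_clm_apply hdd (differentiableAt_const _),
    fderiv_clm_apply hdd (differentiableAt_const _)]
  have hs : IsSymmSndFDerivAt ℝ (fun q => F q i j) p :=
    hsm.isSymmSndFDerivAt (by simpa using WithTop.coe_le_coe.2 (le_top (a := (2 : ℕ∞))))
  simpa using hs (1, 0) (0, 1)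

theorem SmoothOn.mul (hF : SmoothOn D F) (hG : SmoothOn D G) :
    SmoothOn D (fun q => F q * G q) := by
  intro i j
  simp only [Matrix.mul_apply, Fin.sum_univ_two]
  exact ((hF i 0).mul (hG 0 j)).add ((hF i 1).mul (hG 1 j))

/-- For determinant one the adjugate is the inverse, and its entries are polynomial; this is how
smoothness passes to F⁻¹. -/
theorem SmoothOn.adjugate (hF : SmoothOn D F) : SmoothOn D (fun q => (F q).adjugate) := by
  intro i j
  simp only [Matrix.adjugate_fin_two]
  fin_cases i <;> fin_cases j
  · simpa using hF 1 1
  · simpa using (hF 0 1).neg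
  · simpa using (hF 1 0).neg
  · simpa using hF 0 0

theorem linearMap_apply_eq_sum (A : M2 ℝ →ₗ[ℝ] M2 ℝ) (X : M2 ℝ) (i j : Fin 2) :
    A X i j = ∑ k, ∑ l, X k l * A (Matrix.single k l 1) i j := by
  conv_lhs => rw [Matrix.matrix_eq_sum_single X]
  simp only [map_sum, Matrix.sum_apply]
  refine Finset.sum_congr rfl fun k _ => Finset.sum_congr rfl fun l _ => ?_
  have : Matrix.single k l (X k l) = X k l • Matrix.single k l (1 : ℝ) := by
    simp [Matrix.smul_single]
  rw [this, map_smul, Matrix.smul_apply, smul_eq_mul]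

theorem SmoothOn.linearMap (hF : SmoothOn D F) (A : M2 ℝ →ₗ[ℝ] M2 ℝ) :
    SmoothOn D (fun q => A (F q)) := by
  intro i j
  rw [funext fun q => linearMap_apply_eq_sum A (F q) i j]
  exact ContDiffOn.sum fun k _ => ContDiffOn.sum fun l _ => (hF k l).mul contDiffOn_const

theorem SmoothOn.pdx_linearMap (hF : SmoothOn D F) (hD : IsOpen D) (hp : p ∈ D)
    (A : M2 ℝ →ₗ[ℝ] M2 ℝ) : TimelikeCMC.pdx (fun q => A (F q)) p = A (TimelikeCMC.pdx F p) := by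
  ext i j
  refine ((hF.linearMap A).hasDerivAt_x hD hp i j).unique ?_
  rw [funext fun t => linearMap_apply_eq_sum A (F (t, p.2)) i j, linearMap_apply_eq_sum A]
  exact HasDerivAt.fun_sum fun k _ => HasDerivAt.fun_sum fun l _ =>
    (hF.hasDerivAt_x hD hp k l).mul_const _

theorem SmoothOn.pdy_linearMap (hF : SmoothOn D F) (hD : IsOpen D) (hp : p ∈ D)
    (A : M2 ℝ →ₗ[ℝ] M2 ℝ) : TimelikeCMC.pdy (fun q => A (F q)) p = A (TimelikeCMC.pdy F p) := by
  ext i j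
  refine ((hF.linearMap A).hasDerivAt_y hD hp i j).unique ?_
  rw [funext fun t => linearMap_apply_eq_sum A (F (p.1, t)) i j, linearMap_apply_eq_sum A]
  exact HasDerivAt.fun_sum fun k _ => HasDerivAt.fun_sum fun l _ =>
    (hF.hasDerivAt_y hD hp k l).mul_const _

theorem SmoothOn.pdx_mul (hF : SmoothOn D F) (hG : SmoothOn D G) (hD : IsOpen D) (hp : p ∈ D) :
    TimelikeCMC.pdx (fun q => F q * G q) p
      = TimelikeCMC.pdx F p * G p + F p * TimelikeCMC.pdx G p := by
  ext i j
  refine ((hF.mul hG).hasDerivAt_x hD hp i j).unique ?_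
  simp only [Matrix.mul_apply, Matrix.add_apply, ← Finset.sum_add_distrib]
  exact HasDerivAt.fun_sum fun k _ =>
    (hF.hasDerivAt_x hD hp i k).mul (hG.hasDerivAt_x hD hp k j)

theorem SmoothOn.pdy_mul (hF : SmoothOn D F) (hG : SmoothOn D G) (hD : IsOpen D) (hp : p ∈ D) :
    TimelikeCMC.pdy (fun q => F q * G q) p
      = TimelikeCMC.pdy F p * G p + F p * TimelikeCMC.pdy G p := by
  ext i j
  refine ((hF.mul hG).hasDerivAt_y hD hp i j).unique ?_
  simp only [Matrix.mul_apply, Matrix.add_apply, ← Finset.sum_add_distrib]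
  exact HasDerivAt.fun_sum fun k _ =>
    (hF.hasDerivAt_y hD hp i k).mul (hG.hasDerivAt_y hD hp k j)

theorem eventually_prodMk_left_mem (hD : IsOpen D) (hp : p ∈ D) :
    ∀ᶠ t in 𝓝 p.1, (t, p.2) ∈ D :=
  (hasDerivAt_prodMk_left p).continuousAt.eventually (hD.mem_nhds hp)

theorem eventually_prodMk_right_mem (hD : IsOpen D) (hp : p ∈ D) :
    ∀ᶠ t in 𝓝 p.2, (p.1, t) ∈ D :=
  (hasDerivAt_prodMk_right p).continuousAt.eventually (hD.mem_nhds hp)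

theorem pdx_congr (hD : IsOpen D) (hp : p ∈ D) (h : ∀ q ∈ D, F q = G q) :
    pdx F p = pdx G p := by
  ext i j
  simp only [pdx, Matrix.of_apply]
  exact Filter.EventuallyEq.deriv_eq
    ((eventually_prodMk_left_mem hD hp).mono fun t ht => by simp only [h _ ht])

theorem pdy_congr (hD : IsOpen D) (hp : p ∈ D) (h : ∀ q ∈ D, F q = G q) :
    pdy F p = pdy G p := by
  ext i j
  simp only [pdy, Matrix.of_apply]
  exact Filter.EventuallyEq.deriv_eq
    ((eventually_prodMk_right_mem hD hp).mono fun t ht => by simp only [h _ ht])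

theorem SmoothOn.smul (hg : ContDiffOn ℝ ((⊤ : ℕ∞) : WithTop ℕ∞) g D) (hF : SmoothOn D F) :
    SmoothOn D (fun q => g q • F q) := by
  intro i j
  simpa using hg.mul (hF i j)

theorem SmoothOn.pdx_smul {g' : ℝ} (hg : ContDiffOn ℝ ((⊤ : ℕ∞) : WithTop ℕ∞) g D)
    (hg' : HasDerivAt (fun t => g (t, p.2)) g' p.1)
    (hF : SmoothOn D F) (hD : IsOpen D) (hp : p ∈ D) :
    TimelikeCMC.pdx (fun q => g q • F q) p = g' • F p + g p • TimelikeCMC.pdx F p := by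
  ext i j
  refine ((SmoothOn.smul hg hF).hasDerivAt_x hD hp i j).unique ?_
  exact hg'.mul (hF.hasDerivAt_x hD hp i j)

theorem SmoothOn.pdy_smul {g' : ℝ} (hg : ContDiffOn ℝ ((⊤ : ℕ∞) : WithTop ℕ∞) g D)
    (hg' : HasDerivAt (fun t => g (p.1, t)) g' p.2)
    (hF : SmoothOn D F) (hD : IsOpen D) (hp : p ∈ D) :
    TimelikeCMC.pdy (fun q => g q • F q) p = g' • F p + g p • TimelikeCMC.pdy F p := by
  ext i j
  refine ((SmoothOn.smul hg hF).hasDerivAt_y hD hp i j).unique ?_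
  exact hg'.mul (hF.hasDerivAt_y hD hp i j)

theorem SmoothOn.const (C : M2 ℝ) : SmoothOn D (fun _ => C) := fun _ _ => contDiffOn_const

theorem pdx_const (C : M2 ℝ) : pdx (fun _ => C) p = 0 := by
  ext i j; simp [pdx]

theorem pdy_const (C : M2 ℝ) : pdy (fun _ => C) p = 0 := by
  ext i j; simp [pdy]

theorem mink_eq (X Y : M2 ℝ) : mink X Y
    = (1 / 2) * (X 0 0 * Y 0 0 + X 0 1 * Y 1 0 + (X 1 0 * Y 0 1 + X 1 1 * Y 1 1)) := by
  simp [mink, Matrix.trace_fin_two, Matrix.mul_apply, Fin.sum_univ_two]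

theorem SmoothOn.mink (hF : SmoothOn D F) (hG : SmoothOn D G) :
    ContDiffOn ℝ ((⊤ : ℕ∞) : WithTop ℕ∞) (fun q => mink (F q) (G q)) D := by
  simp only [mink_eq]
  exact contDiffOn_const.mul ((((hF 0 0).mul (hG 0 0)).add ((hF 0 1).mul (hG 1 0))).add
    (((hF 1 0).mul (hG 0 1)).add ((hF 1 1).mul (hG 1 1))))

theorem SmoothOn.hasDerivAt_mink_x (hF : SmoothOn D F) (hG : SmoothOn D G) (hD : IsOpen D)
    (hp : p ∈ D) : HasDerivAt (fun t => TimelikeCMC.mink (F (t, p.2)) (G (t, p.2)))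
      (TimelikeCMC.mink (TimelikeCMC.pdx F p) (G p)
        + TimelikeCMC.mink (F p) (TimelikeCMC.pdx G p)) p.1 := by
  have hf := hF.hasDerivAt_x hD hp
  have hg := hG.hasDerivAt_x hD hp
  simp only [mink_eq]
  refine (((((hf 0 0).mul (hg 0 0)).add ((hf 0 1).mul (hg 1 0))).add
    (((hf 1 0).mul (hg 0 1)).add ((hf 1 1).mul (hg 1 1)))).const_mul (1 / 2)).congr_deriv ?_
  ring

theorem SmoothOn.hasDerivAt_mink_y (hF : SmoothOn D F) (hG : SmoothOn D G) (hD : IsOpen D)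
    (hp : p ∈ D) : HasDerivAt (fun t => TimelikeCMC.mink (F (p.1, t)) (G (p.1, t)))
      (TimelikeCMC.mink (TimelikeCMC.pdy F p) (G p)
        + TimelikeCMC.mink (F p) (TimelikeCMC.pdy G p)) p.2 := by
  have hf := hF.hasDerivAt_y hD hp
  have hg := hG.hasDerivAt_y hD hp
  simp only [mink_eq]
  refine (((((hf 0 0).mul (hg 0 0)).add ((hf 0 1).mul (hg 1 0))).add
    (((hf 1 0).mul (hg 0 1)).add ((hf 1 1).mul (hg 1 1)))).const_mul (1 / 2)).congr_deriv ?_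
  ring

theorem SmoothOn.trace_pdx (hF : SmoothOn D F) (hD : IsOpen D) (h : ∀ q ∈ D, (F q).trace = 0)
    (hp : p ∈ D) : (TimelikeCMC.pdx F p).trace = 0 := by
  have h1 := (hF.hasDerivAt_x hD hp 0 0).add (hF.hasDerivAt_x hD hp 1 1)
  rw [Matrix.trace_fin_two]
  refine h1.unique ((hasDerivAt_const p.1 (0 : ℝ)).congr_of_eventuallyEq ?_)
  filter_upwards [eventually_prodMk_left_mem hD hp] with t ht
  simpa [Matrix.trace_fin_two] using h _ ht

theorem SmoothOn.trace_pdy (hF : SmoothOn D F) (hD : IsOpen D) (h : ∀ q ∈ D, (F q).trace = 0)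
    (hp : p ∈ D) : (TimelikeCMC.pdy F p).trace = 0 := by
  have h1 := (hF.hasDerivAt_y hD hp 0 0).add (hF.hasDerivAt_y hD hp 1 1)
  rw [Matrix.trace_fin_two]
  refine h1.unique ((hasDerivAt_const p.2 (0 : ℝ)).congr_of_eventuallyEq ?_)
  filter_upwards [eventually_prodMk_right_mem hD hp] with t ht
  simpa [Matrix.trace_fin_two] using h _ ht

end Calculus

/-! ### The structure equations of a timelike surface of constant mean curvature -/

theorem mink_conj {G : M2 ℝ} (hG : G.det = 1) (X Y : M2 ℝ) :
    mink (G * X * G⁻¹) (G * Y * G⁻¹) = mink X Y := by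
  have hu : IsUnit G.det := by simp [hG]
  have h : G * X * G⁻¹ * (G * Y * G⁻¹) = G * (X * Y) * G⁻¹ := by
    simp only [Matrix.mul_assoc, Matrix.nonsing_inv_mul_cancel_left _ _ hu]
  rw [mink, mink, h, Matrix.trace_mul_comm, Matrix.nonsing_inv_mul_cancel_left _ _ hu]

theorem inv_eq_adjugate {R : Type} [CommRing R] {G : M2 R} (hG : G.det = 1) :
    G⁻¹ = G.adjugate := by
  simp [Matrix.inv_def, hG]

section Surface

variable {D : Set (ℝ × ℝ)} {φ N : ℝ × ℝ → M2 ℝ} {ω : ℝ × ℝ → ℝ} {H : ℝ}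
  {A : M2 ℝ →ₗ[ℝ] M2 ℝ} {F : ℝ × ℝ → M2 ℝ} {p : ℝ × ℝ}

namespace IsTimelikeCMCSurface

theorem exp_eq (hφ : IsTimelikeCMCSurface D φ N ω H) (hp : p ∈ D) :
    mink (pdx φ p) (pdy φ p) = Real.exp (ω p) / 2 := by
  have := congrFun (congrFun (hφ.metric p hp) 0) 1
  simpa [firstForm] using this

/-- Smoothness of ω is not a hypothesis; it follows from ω = log (2⟨φ_x, φ_y⟩). -/
theorem contDiffOn_omega (hφ : IsTimelikeCMCSurface D φ N ω H) (hD : IsOpen D) :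
    ContDiffOn ℝ ((⊤ : ℕ∞) : WithTop ℕ∞) ω D := by
  have h := (contDiffOn_const (c := (2 : ℝ))).mul
    (SmoothOn.mink (hφ.smooth.pdx hD) (hφ.smooth.pdy hD))
  have h2 := h.log fun q hq => by
    rw [hφ.exp_eq hq]; positivity
  refine h2.congr fun q hq => ?_
  rw [hφ.exp_eq hq, mul_div_cancel₀ _ (two_ne_zero), Real.log_exp]

theorem hasDerivAt_omega_x (hφ : IsTimelikeCMCSurface D φ N ω H) (hD : IsOpen D) (hp : p ∈ D) :
    HasDerivAt (fun t => ω (t, p.2)) (fderiv ℝ ω p (1, 0)) p.1 :=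
  hasDerivAt_fst_of_differentiableAt
    (ContDiffOn.differentiableAt_of_isOpen hD (hφ.contDiffOn_omega hD) hp)

theorem hasDerivAt_omega_y (hφ : IsTimelikeCMCSurface D φ N ω H) (hD : IsOpen D) (hp : p ∈ D) :
    HasDerivAt (fun t => ω (p.1, t)) (fderiv ℝ ω p (0, 1)) p.2 :=
  hasDerivAt_snd_of_differentiableAt
    (ContDiffOn.differentiableAt_of_isOpen hD (hφ.contDiffOn_omega hD) hp)

/-- The mixed coefficient of the second fundamental form is `H e^ω / 2`. -/
theorem mink_pdy_pdx (hφ : IsTimelikeCMCSurface D φ N ω H) (hD : IsOpen D) (hp : p ∈ D) :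
    mink (pdy (pdx φ) p) (N p) = H * Real.exp (ω p) / 2 := by
  have h1 : mink (pdy (pdx φ) p) (N p) + mink (pdx φ p) (pdy N p) = 0 := by
    refine ((hφ.smooth.pdx hD).hasDerivAt_mink_y hφ.smooth_normal hD hp).unique
      ((hasDerivAt_const p.2 (0 : ℝ)).congr_of_eventuallyEq ?_)
    filter_upwards [eventually_prodMk_right_mem hD hp] with t ht using hφ.normal_x _ ht
  have h2 : mink (pdx (pdy φ) p) (N p) + mink (pdy φ p) (pdx N p) = 0 := by
    refine ((hφ.smooth.pdy hD).hasDerivAt_mink_x hφ.smooth_normal hD hp).unique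
      ((hasDerivAt_const p.1 (0 : ℝ)).congr_of_eventuallyEq ?_)
    filter_upwards [eventually_prodMk_left_mem hD hp] with t ht using hφ.normal_y _ ht
  rw [hφ.smooth.pdx_pdy_comm hD hp] at h2
  have h3 := hφ.mean p hp
  have he : Real.exp (ω p) ≠ 0 := (Real.exp_pos _).ne'
  -- The metric is off-diagonal, so the trace sees only the two mixed entries of the second
  -- fundamental form, and these agree by `h1`, `h2` and φ_xy = φ_yx.
  have hinv : (firstForm φ p)⁻¹ = !![0, 2 / Real.exp (ω p); 2 / Real.exp (ω p), 0] := by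
    rw [hφ.metric p hp]
    refine Matrix.inv_eq_right_inv ?_
    ext i j
    fin_cases i <;> fin_cases j <;> simp [Matrix.mul_apply, Fin.sum_univ_two]
  rw [meanCurvature, hinv, secondForm] at h3
  simp only [Matrix.trace_fin_two, Matrix.mul_apply, Fin.sum_univ_two, Matrix.of_apply,
    Matrix.cons_val', Matrix.cons_val_zero, Matrix.cons_val_one, Matrix.cons_val_fin_one] at h3
  field_simp at h3
  linarith

end IsTimelikeCMCSurface

/-- The conformal factor `e^{ω/2}`. -/
def halfExp (ω : ℝ × ℝ → ℝ) (p : ℝ × ℝ) : ℝ := Real.exp (ω p / 2)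

theorem halfExp_pos (ω : ℝ × ℝ → ℝ) (p : ℝ × ℝ) : 0 < halfExp ω p := Real.exp_pos _

theorem halfExp_mul_self (ω : ℝ × ℝ → ℝ) (p : ℝ × ℝ) :
    halfExp ω p * halfExp ω p = Real.exp (ω p) := by
  rw [halfExp, ← Real.exp_add]; ring_nf

namespace IsCoordinateFrame

theorem isUnit_det (hF : IsCoordinateFrame D φ N ω A F) (hp : p ∈ D) : IsUnit (F p).det := by
  simp [hF.det_one p hp]

/-- The frame vectors j' and i differ by 2E₁₂, and the corresponding tangent vectors by a multiple
of φ_x. With F kept on the right, differentiation needs no derivative of F⁻¹. -/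
theorem map_pdx (hF : IsCoordinateFrame D φ N ω A F) (hp : p ∈ D) :
    A (pdx φ p) * F p = halfExp ω p • (F p * !![0, 1; 0, 0]) := by
  have hi := hF.ad_i p hp
  have hj := hF.ad_j p hp
  have he : Real.exp (-ω p / 2) = (halfExp ω p)⁻¹ := by
    rw [halfExp, ← Real.exp_neg, neg_div]
  have hx : A (pdx φ p) = (halfExp ω p / 2) • (F p * (bj - bi) * (F p)⁻¹) := by
    rw [mul_sub, sub_mul, hi, hj, ← map_sub, ← map_smul, he, ← smul_sub, smul_smul]
    congr 1
    rw [show pdx φ p + pdy φ p - (-pdx φ p + pdy φ p) = (2 : ℝ) • pdx φ p by rw [two_smul]; abel,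
      smul_smul, show halfExp ω p / 2 * (halfExp ω p)⁻¹ * 2 = 1 by
        have := (halfExp_pos ω p).ne'; field_simp, one_smul]
  have hb : bj - bi = (2 : ℝ) • !![0, 1; 0, 0] := by
    ext i j; fin_cases i <;> fin_cases j <;> simp [bi, bj]; norm_num
  rw [hx, hb, Matrix.smul_mul, Matrix.nonsing_inv_mul_cancel_right _ _ (hF.isUnit_det hp),
    Matrix.mul_smul, smul_smul]
  congr 1; ring

theorem map_pdy (hF : IsCoordinateFrame D φ N ω A F) (hp : p ∈ D) :
    A (pdy φ p) * F p = halfExp ω p • (F p * !![0, 0; 1, 0]) := by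
  have hi := hF.ad_i p hp
  have hj := hF.ad_j p hp
  have he : Real.exp (-ω p / 2) = (halfExp ω p)⁻¹ := by
    rw [halfExp, ← Real.exp_neg, neg_div]
  have hx : A (pdy φ p) = (halfExp ω p / 2) • (F p * (bi + bj) * (F p)⁻¹) := by
    rw [mul_add, add_mul, hi, hj, ← map_add, ← map_smul, he, ← smul_add, smul_smul]
    congr 1
    rw [show -pdx φ p + pdy φ p + (pdx φ p + pdy φ p) = (2 : ℝ) • pdy φ p by rw [two_smul]; abel,
      smul_smul, show halfExp ω p / 2 * (halfExp ω p)⁻¹ * 2 = 1 by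
        have := (halfExp_pos ω p).ne'; field_simp, one_smul]
  have hb : bi + bj = (2 : ℝ) • !![0, 0; 1, 0] := by
    ext i j; fin_cases i <;> fin_cases j <;> simp [bi, bj]; norm_num
  rw [hx, hb, Matrix.smul_mul, Matrix.nonsing_inv_mul_cancel_right _ _ (hF.isUnit_det hp),
    Matrix.mul_smul, smul_smul]
  congr 1; ring

theorem mul_inv_mul (hF : IsCoordinateFrame D φ N ω A F) (hp : p ∈ D) (X : M2 ℝ) :
    F p * ((F p)⁻¹ * X) = X :=
  Matrix.mul_nonsing_inv_cancel_left _ _ (hF.isUnit_det hp)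

/-- A second derivative of the surface in terms of the frame and its Maurer-Cartan form. -/
theorem eq_conj_of_derivative (hF : IsCoordinateFrame D φ N ω A F) (hp : p ∈ D)
    {X X' W E : M2 ℝ} {e e' : ℝ} (h : X * F p = e • (F p * E))
    (h' : X' * F p + X * (F p * W) = e' • (F p * E) + e • (F p * W * E)) :
    X' = F p * (e' • E + e • (W * E - E * W)) * (F p)⁻¹ := by
  have h1 : X' * F p = F p * (e' • E + e • (W * E - E * W)) := by
    -- Replacing X F by e F E turns the term X F W into e F E W, the second half of the commutator.
    rw [← Matrix.mul_assoc, h, Matrix.smul_mul] at h'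
    rw [eq_sub_of_add_eq h']
    simp only [mul_add, mul_sub, Matrix.mul_smul, smul_sub, Matrix.mul_assoc]
    abel
  rw [← h1, Matrix.mul_nonsing_inv_cancel_right _ _ (hF.isUnit_det hp)]

/-- Both A and conjugation by F preserve the scalar product, so the ambient isometry drops out here.
The trace condition is needed because A is isometric only on trace-free matrices. -/
theorem mink_map_normal (hF : IsCoordinateFrame D φ N ω A F) (hφ : IsTimelikeCMCSurface D φ N ω H)
    (hA : IsLorentzIsometry A) (hp : p ∈ D) {X Y : M2 ℝ} (hX : X.trace = 0)
    (h : A X = F p * Y * (F p)⁻¹) : mink X (N p) = mink Y bk := by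
  rw [← hA.isometry _ _ hX (hφ.trace_zero_normal p hp), ← hF.ad_k p hp, h,
    mink_conj (hF.det_one p hp)]

/-- This is the derivative of det F = 1. -/
theorem trace_inv_mul_pdx (hF : IsCoordinateFrame D φ N ω A F) (hD : IsOpen D) (hp : p ∈ D) :
    ((F p)⁻¹ * pdx F p) 1 1 = -((F p)⁻¹ * pdx F p) 0 0 := by
  have hd := hF.smooth.hasDerivAt_x hD hp
  have h := (((hd 0 0).mul (hd 1 1)).sub ((hd 0 1).mul (hd 1 0))).unique
    ((hasDerivAt_const p.1 (1 : ℝ)).congr_of_eventuallyEq (by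
      filter_upwards [eventually_prodMk_left_mem hD hp] with t ht
      simpa [Matrix.det_fin_two] using hF.det_one _ ht))
  rw [inv_eq_adjugate (hF.det_one p hp), Matrix.adjugate_fin_two]
  simp [Matrix.mul_apply, Fin.sum_univ_two]
  linarith

theorem trace_inv_mul_pdy (hF : IsCoordinateFrame D φ N ω A F) (hD : IsOpen D) (hp : p ∈ D) :
    ((F p)⁻¹ * pdy F p) 1 1 = -((F p)⁻¹ * pdy F p) 0 0 := by
  have hd := hF.smooth.hasDerivAt_y hD hp
  have h := (((hd 0 0).mul (hd 1 1)).sub ((hd 0 1).mul (hd 1 0))).unique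
    ((hasDerivAt_const p.2 (1 : ℝ)).congr_of_eventuallyEq (by
      filter_upwards [eventually_prodMk_right_mem hD hp] with t ht
      simpa [Matrix.det_fin_two] using hF.det_one _ ht))
  rw [inv_eq_adjugate (hF.det_one p hp), Matrix.adjugate_fin_two]
  simp [Matrix.mul_apply, Fin.sum_univ_two]
  linarith

end IsCoordinateFrame

/-- The entries of the Maurer-Cartan form `U dx + V dy` of a coordinate frame. -/
structure FrameEquations (φ N : ℝ × ℝ → M2 ℝ) (ω : ℝ × ℝ → ℝ) (H : ℝ) (U V : M2 ℝ)
    (p : ℝ × ℝ) : Prop where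
  u00 : U 0 0 = fderiv ℝ ω p (1, 0) / 4
  u11 : U 1 1 = -(fderiv ℝ ω p (1, 0) / 4)
  u01 : U 0 1 = -(H / 2) * halfExp ω p
  u10 : halfExp ω p * U 1 0 = hopfQ φ N p
  v00 : V 0 0 = -(fderiv ℝ ω p (0, 1) / 4)
  v11 : V 1 1 = fderiv ℝ ω p (0, 1) / 4
  v01 : halfExp ω p * V 0 1 = -hopfR φ N p
  v10 : V 1 0 = H / 2 * halfExp ω p


theorem contDiffOn_halfExp (hφ : IsTimelikeCMCSurface D φ N ω H) (hD : IsOpen D) :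
    ContDiffOn ℝ ((⊤ : ℕ∞) : WithTop ℕ∞) (halfExp ω) D :=
  ((hφ.contDiffOn_omega hD).div_const 2).exp

theorem hasDerivAt_halfExp_x (hφ : IsTimelikeCMCSurface D φ N ω H) (hD : IsOpen D)
    (hp : p ∈ D) : HasDerivAt (fun t => halfExp ω (t, p.2))
    (halfExp ω p * (fderiv ℝ ω p (1, 0) / 2)) p.1 :=
  ((hφ.hasDerivAt_omega_x hD hp).div_const 2).exp

theorem hasDerivAt_halfExp_y (hφ : IsTimelikeCMCSurface D φ N ω H) (hD : IsOpen D)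
    (hp : p ∈ D) : HasDerivAt (fun t => halfExp ω (p.1, t))
    (halfExp ω p * (fderiv ℝ ω p (0, 1) / 2)) p.2 :=
  ((hφ.hasDerivAt_omega_y hD hp).div_const 2).exp

/-- The three second derivatives are conjugates of e'E + e[W, E] with e = e^{ω/2}, E one of E₁₂, E₂₁
and W one of U, V. Their normal components give `u10`, `v10` and `v01`; comparing the two
expressions for φ_xy gives the remaining entries. -/
theorem frameEquations (hφ : IsTimelikeCMCSurface D φ N ω H) (hD : IsOpen D)
    (hA : IsLorentzIsometry A) (hF : IsCoordinateFrame D φ N ω A F)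
    (hp : p ∈ D) :
    FrameEquations φ N ω H ((F p)⁻¹ * pdx F p) ((F p)⁻¹ * pdy F p) p := by
  set U := (F p)⁻¹ * pdx F p with hU
  set V := (F p)⁻¹ * pdy F p with hV
  have hFU : pdx F p = F p * U := (hF.mul_inv_mul hp _).symm
  have hFV : pdy F p = F p * V := (hF.mul_inv_mul hp _).symm
  have hXs := (hφ.smooth.pdx hD).linearMap A
  have hYs := (hφ.smooth.pdy hD).linearMap A
  have hes := contDiffOn_halfExp hφ hD
  have hex := hasDerivAt_halfExp_x hφ hD hp
  have hey := hasDerivAt_halfExp_y hφ hD hp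
  have mulC : ∀ C : M2 ℝ, SmoothOn D fun q => F q * C := fun C => hF.smooth.mul (SmoothOn.const C)
  have hxC : ∀ C : M2 ℝ, pdx (fun q => F q * C) p = F p * U * C := fun C => by
    rw [hF.smooth.pdx_mul (SmoothOn.const C) hD hp, pdx_const, mul_zero, add_zero, hFU]
  have hyC : ∀ C : M2 ℝ, pdy (fun q => F q * C) p = F p * V * C := fun C => by
    rw [hF.smooth.pdy_mul (SmoothOn.const C) hD hp, pdy_const, mul_zero, add_zero, hFV]
  have hxx := hF.eq_conj_of_derivative hp (hF.map_pdx hp) (by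
    have h := pdx_congr hD hp fun q hq => hF.map_pdx hq
    rwa [hXs.pdx_mul hF.smooth hD hp, (hφ.smooth.pdx hD).pdx_linearMap hD hp, hFU,
      SmoothOn.pdx_smul hes hex (mulC _) hD hp, hxC] at h)
  have hxy := hF.eq_conj_of_derivative hp (hF.map_pdx hp) (by
    have h := pdy_congr hD hp fun q hq => hF.map_pdx hq
    rwa [hXs.pdy_mul hF.smooth hD hp, (hφ.smooth.pdx hD).pdy_linearMap hD hp, hFV,
      SmoothOn.pdy_smul hes hey (mulC _) hD hp, hyC] at h)
  have hyx := hF.eq_conj_of_derivative hp (hF.map_pdy hp) (by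
    have h := pdx_congr hD hp fun q hq => hF.map_pdy hq
    rwa [hYs.pdx_mul hF.smooth hD hp, (hφ.smooth.pdy hD).pdx_linearMap hD hp, hFU,
      SmoothOn.pdx_smul hes hex (mulC _) hD hp, hxC] at h)
  have hyy := hF.eq_conj_of_derivative hp (hF.map_pdy hp) (by
    have h := pdy_congr hD hp fun q hq => hF.map_pdy hq
    rwa [hYs.pdy_mul hF.smooth hD hp, (hφ.smooth.pdy hD).pdy_linearMap hD hp, hFV,
      SmoothOn.pdy_smul hes hey (mulC _) hD hp, hyC] at h)
  have htx : ∀ q ∈ D, (pdx φ q).trace = 0 := fun q hq =>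
    hφ.smooth.trace_pdx hD hφ.trace_zero hq
  have hty : ∀ q ∈ D, (pdy φ q).trace = 0 := fun q hq =>
    hφ.smooth.trace_pdy hD hφ.trace_zero hq
  have hQ := hF.mink_map_normal hφ hA hp ((hφ.smooth.pdx hD).trace_pdx hD htx hp) hxx
  have hM := hF.mink_map_normal hφ hA hp ((hφ.smooth.pdx hD).trace_pdy hD htx hp) hxy
  have hR := hF.mink_map_normal hφ hA hp ((hφ.smooth.pdy hD).trace_pdy hD hty hp) hyy
  rw [hφ.mink_pdy_pdx hD hp, ← halfExp_mul_self] at hM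
  have hsymm := hxy
  rw [← hφ.smooth.pdx_pdy_comm hD hp, hyx] at hsymm
  have hu := hF.isUnit_det hp
  have hsymm' := congrArg (fun Z => (F p)⁻¹ * (Z * F p)) hsymm
  simp only [Matrix.nonsing_inv_mul_cancel_right _ _ hu,
    Matrix.nonsing_inv_mul_cancel_left _ _ hu] at hsymm'
  have hpos := halfExp_pos ω p
  -- The diagonal entry says that the upper right entry of U is minus the lower left entry of V. The
  -- off-diagonal entries say that φ_xy has no tangential part, which fixes both diagonals.
  have h00 := congrFun (congrFun hsymm' 0) 0
  have h01 := congrFun (congrFun hsymm' 0) 1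
  have h10 := congrFun (congrFun hsymm' 1) 0
  have tU : U 1 1 = -U 0 0 := hF.trace_inv_mul_pdx hD hp
  have tV : V 1 1 = -V 0 0 := hF.trace_inv_mul_pdy hD hp
  have hQ' : hopfQ φ N p = _ := hQ
  have hR' : hopfR φ N p = _ := hR
  clear_value U V
  simp only [mink_eq, bk, Matrix.add_apply, Matrix.sub_apply, Matrix.smul_apply, Matrix.mul_apply,
    Fin.sum_univ_two, Matrix.of_apply, smul_eq_mul,
    Matrix.cons_val', Matrix.cons_val_zero, Matrix.cons_val_one, Matrix.cons_val_fin_one]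
    at hQ' hM hR' h00 h01 h10
  ring_nf at hQ' hM hR' h00 h01 h10
  have hv10 : V 1 0 = H / 2 * halfExp ω p := by
    refine mul_left_cancel₀ hpos.ne' ?_
    linarith
  have hu00 : U 0 0 = fderiv ℝ ω p (1, 0) / 4 := by
    refine mul_left_cancel₀ hpos.ne' ?_
    rw [tU] at h10
    linarith
  have hv00 : V 0 0 = -(fderiv ℝ ω p (0, 1) / 4) := by
    refine mul_left_cancel₀ hpos.ne' ?_
    rw [tV] at h01
    linarith
  have hu01 : U 0 1 = -(H / 2) * halfExp ω p := by
    refine mul_left_cancel₀ hpos.ne' ?_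
    linarith
  exact ⟨hu00, by rw [tU, hu00], hu01, by linarith, hv00, by rw [tV, hv00, neg_neg], by linarith,
    hv10⟩

end Surface

/-! ### The Maurer-Cartan and Codazzi equations -/

section Surface

variable {D : Set (ℝ × ℝ)} {φ N : ℝ × ℝ → M2 ℝ} {ω : ℝ × ℝ → ℝ} {H : ℝ}
  {A : M2 ℝ →ₗ[ℝ] M2 ℝ} {F : ℝ × ℝ → M2 ℝ} {p : ℝ × ℝ}

theorem IsCoordinateFrame.smoothOn_inv_mul (hF : IsCoordinateFrame D φ N ω A F)
    {G : ℝ × ℝ → M2 ℝ} (hG : SmoothOn D G) : SmoothOn D (fun q => (F q)⁻¹ * G q) := by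
  intro i j
  refine (hF.smooth.adjugate.mul hG i j).congr fun q hq => ?_
  beta_reduce
  rw [inv_eq_adjugate (hF.det_one q hq)]

/-- The Maurer-Cartan equation. -/
theorem IsCoordinateFrame.maurerCartan (hF : IsCoordinateFrame D φ N ω A F) (hD : IsOpen D)
    {U V : ℝ × ℝ → M2 ℝ} (hU : ∀ q, U q = (F q)⁻¹ * pdx F q) (hV : ∀ q, V q = (F q)⁻¹ * pdy F q)
    (hp : p ∈ D) : pdy U p + V p * U p = pdx V p + U p * V p := by
  have hUs : SmoothOn D U := by
    rw [funext hU]; exact hF.smoothOn_inv_mul (hF.smooth.pdx hD)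
  have hVs : SmoothOn D V := by
    rw [funext hV]; exact hF.smoothOn_inv_mul (hF.smooth.pdy hD)
  have hFU : ∀ q ∈ D, F q * U q = pdx F q := fun q hq => by rw [hU, hF.mul_inv_mul hq]
  have hFV : ∀ q ∈ D, F q * V q = pdy F q := fun q hq => by rw [hV, hF.mul_inv_mul hq]
  have hy := hF.smooth.pdy_mul hUs hD hp
  have hx := hF.smooth.pdx_mul hVs hD hp
  rw [pdy_congr hD hp hFU, ← hFV p hp] at hy
  rw [pdx_congr hD hp hFV, hF.smooth.pdx_pdy_comm hD hp, hy, ← hFU p hp] at hx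
  have h := congrArg (fun Z => (F p)⁻¹ * Z) hx
  simp only [mul_add, Matrix.mul_assoc,
    Matrix.nonsing_inv_mul_cancel_left _ _ (hF.isUnit_det hp)] at h
  rw [add_comm, h, add_comm]

/-- The Codazzi equation: `Q` does not depend on `y`. -/
theorem hasDerivAt_hopfQ (hφ : IsTimelikeCMCSurface D φ N ω H) (hD : IsOpen D)
    (hA : IsLorentzIsometry A) (hF : IsCoordinateFrame D φ N ω A F)
    (hp : p ∈ D) : HasDerivAt (fun t => hopfQ φ N (p.1, t)) 0 p.2 := by
  obtain ⟨U, hU⟩ : ∃ U : ℝ × ℝ → M2 ℝ, ∀ q, U q = (F q)⁻¹ * pdx F q := ⟨_, fun _ => rfl⟩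
  obtain ⟨V, hV⟩ : ∃ V : ℝ × ℝ → M2 ℝ, ∀ q, V q = (F q)⁻¹ * pdy F q := ⟨_, fun _ => rfl⟩
  have hUs : SmoothOn D U := by
    rw [funext hU]; exact hF.smoothOn_inv_mul (hF.smooth.pdx hD)
  have hVs : SmoothOn D V := by
    rw [funext hV]; exact hF.smoothOn_inv_mul (hF.smooth.pdy hD)
  have fe : ∀ q ∈ D, FrameEquations φ N ω H (U q) (V q) q := fun q hq => by
    rw [hU, hV]; exact frameEquations hφ hD hA hF hq
  have hMC := congrFun (congrFun (hF.maurerCartan hD hU hV hp) 1) 0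
  -- Constancy of H enters here: the x-derivative of (H/2)e^{ω/2} has no H_x term, and it cancels
  -- against the diagonal of U.
  have hV' := (hVs.hasDerivAt_x hD hp 1 0).unique
    (((hasDerivAt_halfExp_x hφ hD hp).const_mul (H / 2)).congr_of_eventuallyEq
      ((eventually_prodMk_left_mem hD hp).mono fun t ht => (fe _ ht).v10))
  refine (((hasDerivAt_halfExp_y hφ hD hp).mul
    (hUs.hasDerivAt_y hD hp 1 0)).congr_of_eventuallyEq
    ((eventually_prodMk_right_mem hD hp).mono fun t ht => (fe _ ht).u10.symm)).congr_deriv ?_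
  have f := fe p hp
  simp only [Matrix.add_apply, Matrix.mul_apply, Fin.sum_univ_two] at hMC
  rw [hV', f.u00, f.u11, f.v00, f.v11, f.v10] at hMC
  rw [eq_sub_of_add_eq hMC]
  ring

/-- The Codazzi equation: `R` does not depend on `x`. -/
theorem hasDerivAt_hopfR (hφ : IsTimelikeCMCSurface D φ N ω H) (hD : IsOpen D)
    (hA : IsLorentzIsometry A) (hF : IsCoordinateFrame D φ N ω A F)
    (hp : p ∈ D) : HasDerivAt (fun t => hopfR φ N (t, p.2)) 0 p.1 := by
  obtain ⟨U, hU⟩ : ∃ U : ℝ × ℝ → M2 ℝ, ∀ q, U q = (F q)⁻¹ * pdx F q := ⟨_, fun _ => rfl⟩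
  obtain ⟨V, hV⟩ : ∃ V : ℝ × ℝ → M2 ℝ, ∀ q, V q = (F q)⁻¹ * pdy F q := ⟨_, fun _ => rfl⟩
  have hUs : SmoothOn D U := by
    rw [funext hU]; exact hF.smoothOn_inv_mul (hF.smooth.pdx hD)
  have hVs : SmoothOn D V := by
    rw [funext hV]; exact hF.smoothOn_inv_mul (hF.smooth.pdy hD)
  have fe : ∀ q ∈ D, FrameEquations φ N ω H (U q) (V q) q := fun q hq => by
    rw [hU, hV]; exact frameEquations hφ hD hA hF hq
  have hMC := congrFun (congrFun (hF.maurerCartan hD hU hV hp) 0) 1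
  have hU' := (hUs.hasDerivAt_y hD hp 0 1).unique
    (((hasDerivAt_halfExp_y hφ hD hp).const_mul (-(H / 2))).congr_of_eventuallyEq
      ((eventually_prodMk_right_mem hD hp).mono fun t ht => (fe _ ht).u01))
  refine (((hasDerivAt_halfExp_x hφ hD hp).mul
    (hVs.hasDerivAt_x hD hp 0 1)).neg.congr_of_eventuallyEq
    ((eventually_prodMk_left_mem hD hp).mono fun t ht =>
      (neg_eq_iff_eq_neg.2 (fe _ ht).v01).symm)).congr_deriv ?_
  have f := fe p hp
  simp only [Matrix.add_apply, Matrix.mul_apply, Fin.sum_univ_two] at hMC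
  rw [hU', f.u00, f.u11, f.v00, f.v11, f.u01] at hMC
  rw [eq_sub_of_add_eq hMC.symm]
  ring

end Surface

theorem eq_of_hasDerivAt_zero {g : ℝ → ℝ} {a b : ℝ} (h : ∀ t ∈ uIcc a b, HasDerivAt g 0 t) :
    g b = g a := by
  have := (convex_uIcc a b).norm_image_sub_le_of_norm_hasDerivWithin_le (f' := fun _ => 0)
    (fun t ht => (h t ht).hasDerivWithinAt) (C := 0) (by simp) left_mem_uIcc right_mem_uIcc
  simpa [sub_eq_zero] using this

/-! ### Matrices over the complex numbers -/

theorem toC_mul (X Y : M2 ℝ) : toC (X * Y) = toC X * toC Y := by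
  ext i j; simp [toC, Matrix.mul_apply]

theorem toC_one : toC 1 = 1 := by
  ext i j; fin_cases i <;> fin_cases j <;> simp [toC]

/-- The diagonal trace-free matrix with upper left entry `a`. -/
def diagGen (a : ℝ) : M2 ℝ := !![a, 0; 0, -a]

/-- The one-parameter group `exp (diagGen a)`. -/
def boost (a : ℝ) : M2 ℝ := !![Real.exp a, 0; 0, Real.exp (-a)]

theorem boost_zero : boost 0 = 1 := by
  ext i j; fin_cases i <;> fin_cases j <;> simp [boost]

theorem boost_mul (a b : ℝ) : boost a * boost b = boost (a + b) := by
  ext i j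
  fin_cases i <;> fin_cases j <;>
    simp [boost, Matrix.mul_apply, Fin.sum_univ_two, ← Real.exp_add, add_comm]

theorem boost_mul_neg (a : ℝ) : boost a * boost (-a) = 1 := by
  rw [boost_mul, add_neg_cancel, boost_zero]

theorem boost_mul_diagGen (a b : ℝ) : boost a * diagGen b = diagGen b * boost a := by
  ext i j
  fin_cases i <;> fin_cases j <;>
    simp [boost, diagGen, Matrix.mul_apply, Fin.sum_univ_two, mul_comm]

theorem det_boost (a : ℝ) : (boost a).det = 1 := by
  simp [boost, Matrix.det_fin_two, ← Real.exp_add]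

theorem det_toC (X : M2 ℝ) : (toC X).det = (X.det : ℂ) := by
  simp [toC, Matrix.det_fin_two]

theorem sigma_apply (X : M2 ℂ) : sigma X = !![X 0 0, -X 0 1; -X 1 0, X 1 1] := by
  have h : (toC bk)⁻¹ = toC bk := by
    refine Matrix.inv_eq_right_inv ?_
    ext i j
    fin_cases i <;> fin_cases j <;> simp [toC, bk, Matrix.mul_apply, Fin.sum_univ_two]
  rw [sigma, h]
  ext i j
  fin_cases i <;> fin_cases j <;> simp [toC, bk, Matrix.mul_apply, Fin.sum_univ_two]

theorem sigma_mul (X Y : M2 ℂ) : sigma (X * Y) = sigma X * sigma Y := by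
  simp only [sigma_apply]
  ext i j
  fin_cases i <;> fin_cases j <;> simp [Matrix.mul_apply, Fin.sum_univ_two] <;> ring

theorem sigma_adjugate (X : M2 ℂ) : sigma X.adjugate = (sigma X).adjugate := by
  simp only [sigma_apply, Matrix.adjugate_fin_two]
  ext i j
  fin_cases i <;> fin_cases j <;> simp

theorem sigma_toC_boost (a : ℝ) : sigma (toC (boost a)) = toC (boost a) := by
  rw [sigma_apply]
  ext i j
  fin_cases i <;> fin_cases j <;> simp [toC, boost]

theorem kPart_toC {U : M2 ℝ} (h : U 1 1 = -U 0 0) : kPart (toC U) = toC (diagGen (U 0 0)) := by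
  rw [kPart, sigma_apply]
  ext i j
  fin_cases i <;> fin_cases j <;> simp [toC, diagGen, h] <;> ring

theorem mPart_toC (U : M2 ℝ) : mPart (toC U) = toC !![0, U 0 1; U 1 0, 0] := by
  rw [mPart, sigma_apply]
  ext i j
  fin_cases i <;> fin_cases j <;> simp [toC] <;> ring

theorem adjugate_mul_of_det_one {X : M2 ℂ} (h : X.det = 1) : X.adjugate * X = 1 := by
  rw [Matrix.adjugate_mul, h, one_smul]

theorem mul_adjugate_of_det_one {X : M2 ℂ} (h : X.det = 1) : X * X.adjugate = 1 := by
  rw [Matrix.mul_adjugate, h, one_smul]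

theorem differentiableOn_mul_entries {s : Set ℂ} {X Y : ℂ → M2 ℂ}
    (hX : ∀ i j, DifferentiableOn ℂ (fun l => X l i j) s)
    (hY : ∀ i j, DifferentiableOn ℂ (fun l => Y l i j) s) (i j : Fin 2) :
    DifferentiableOn ℂ (fun l => (X l * Y l) i j) s := by
  simp only [Matrix.mul_apply, Fin.sum_univ_two]
  exact ((hX i 0).mul (hY 0 j)).add ((hX i 1).mul (hY 1 j))

theorem differentiable_mul_entries {X Y : ℂ → M2 ℂ}
    (hX : ∀ i j, Differentiable ℂ (fun l => X l i j))
    (hY : ∀ i j, Differentiable ℂ (fun l => Y l i j)) (i j : Fin 2) :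
    Differentiable ℂ (fun l => (X l * Y l) i j) := by
  simp only [← differentiableOn_univ] at *
  exact differentiableOn_mul_entries hX hY i j

theorem differentiableOn_adjugate_entries {s : Set ℂ} {X : ℂ → M2 ℂ}
    (hX : ∀ i j, DifferentiableOn ℂ (fun l => X l i j) s) (i j : Fin 2) :
    DifferentiableOn ℂ (fun l => (X l).adjugate i j) s := by
  simp only [Matrix.adjugate_fin_two]
  fin_cases i <;> fin_cases j
  · simpa using hX 1 1
  · simpa using (hX 0 1).neg
  · simpa using (hX 1 0).neg
  · simpa using hX 0 0

theorem differentiable_adjugate_entries {X : ℂ → M2 ℂ}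
    (hX : ∀ i j, Differentiable ℂ (fun l => X l i j)) (i j : Fin 2) :
    Differentiable ℂ (fun l => (X l).adjugate i j) := by
  simp only [← differentiableOn_univ] at *
  exact differentiableOn_adjugate_entries hX i j

theorem hasDerivAt_mul_entries {X Y : ℝ → M2 ℂ} {X' Y' : M2 ℂ} {t : ℝ}
    (hX : ∀ i j, HasDerivAt (fun s => X s i j) (X' i j) t)
    (hY : ∀ i j, HasDerivAt (fun s => Y s i j) (Y' i j) t) (i j : Fin 2) :
    HasDerivAt (fun s => (X s * Y s) i j) ((X' * Y t + X t * Y') i j) t := by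
  simp only [Matrix.mul_apply, Matrix.add_apply, ← Finset.sum_add_distrib]
  exact HasDerivAt.fun_sum fun k _ => (hX i k).mul (hY k j)

theorem hasDerivAt_toC_boost {b : ℝ → ℝ} {b' t : ℝ} (hb : HasDerivAt b b' t) (i j : Fin 2) :
    HasDerivAt (fun s => toC (boost (b s)) i j) (toC (boost (b t) * diagGen b') i j) t := by
  fin_cases i <;> fin_cases j
  · simpa [toC, boost, diagGen, Matrix.mul_apply] using hb.exp.ofReal_comp
  · simpa [toC, boost, diagGen, Matrix.mul_apply] using hasDerivAt_const t (0 : ℂ)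
  · simpa [toC, boost, diagGen, Matrix.mul_apply] using hasDerivAt_const t (0 : ℂ)
  · simpa [toC, boost, diagGen, Matrix.mul_apply] using hb.neg.exp.ofReal_comp

/-- The scalar r is the speed of a segment rescaled to [0, 1]; it is absorbed into the coefficients,
so the equation keeps its shape. -/
theorem smul_mul_toC_diagGen_add (X : M2 ℂ) (r a : ℝ) (l : ℂ) (M : M2 ℝ) :
    r • (X * (toC (diagGen a) + l • toC M))
      = X * (toC (diagGen (a * r)) + l • toC (r • M)) := by
  rw [← Matrix.mul_smul]
  congr 1
  ext i j
  fin_cases i <;> fin_cases j <;> simp [toC, diagGen] <;> ring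

/-- Gauging away the diagonal part of a linear differential equation. -/
theorem hasDerivAt_mul_boost {X : ℝ → M2 ℂ} {b : ℝ → ℝ} {a t : ℝ} {l : ℂ} {M : M2 ℝ}
    (hX : ∀ i j, HasDerivAt (fun s => X s i j) ((X t * (toC (diagGen a) + l • toC M)) i j) t)
    (hb : HasDerivAt b (-a) t) (i j : Fin 2) :
    HasDerivAt (fun s => (X s * toC (boost (b s))) i j)
      ((X t * toC (boost (b t)) * (l • toC (boost (-b t) * M * boost (b t)))) i j) t := by
  refine (hasDerivAt_mul_entries hX (hasDerivAt_toC_boost hb) i j).congr_deriv ?_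
  have h1 : diagGen (-a) = -diagGen a := by
    ext i j; fin_cases i <;> fin_cases j <;> simp [diagGen]
  have h2 : toC (-diagGen a * boost (b t)) = -(toC (diagGen a) * toC (boost (b t))) := by
    rw [← toC_mul]; ext i j; simp [toC]
  have h3 : X t * toC (boost (b t)) * (l • toC (boost (-b t) * M * boost (b t)))
      = X t * (l • (toC M * toC (boost (b t)))) := by
    rw [Matrix.mul_smul, Matrix.mul_smul, Matrix.mul_assoc, ← toC_mul, ← toC_mul,
      ← Matrix.mul_assoc, ← Matrix.mul_assoc, boost_mul_neg, Matrix.one_mul]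
  have h4 : (X t * (toC (diagGen a) + l • toC M)) * toC (boost (b t))
      + X t * -(toC (diagGen a) * toC (boost (b t))) = X t * (l • (toC M * toC (boost (b t)))) := by
    rw [Matrix.mul_assoc, ← mul_add, add_mul, Matrix.smul_mul, add_neg_cancel_comm]
  rw [boost_mul_diagGen, h1, h2, h3, h4]

/-! ### Twisted loops -/

namespace IsTwistedLoop

variable {γ δ : ℂ → M2 ℂ}

theorem mul (hγ : IsTwistedLoop γ) (hδ : IsTwistedLoop δ) :
    IsTwistedLoop fun l => γ l * δ l where
  analytic := differentiableOn_mul_entries hγ.analytic hδ.analytic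
  det_one l hl := by rw [Matrix.det_mul, hγ.det_one l hl, hδ.det_one l hl, one_mul]
  real_coeff l hl i j := by
    simp [Matrix.mul_apply, hγ.real_coeff l hl, hδ.real_coeff l hl]
  twisted l hl := by rw [sigma_mul, hγ.twisted l hl, hδ.twisted l hl]

theorem adjugate (hγ : IsTwistedLoop γ) : IsTwistedLoop fun l => (γ l).adjugate where
  analytic := differentiableOn_adjugate_entries hγ.analytic
  det_one l hl := by rw [Matrix.det_adjugate, hγ.det_one l hl, one_pow]
  real_coeff l hl i j := by
    simp only [Matrix.adjugate_fin_two]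
    fin_cases i <;> fin_cases j <;> simp [hγ.real_coeff l hl]
  twisted l hl := by rw [sigma_adjugate, hγ.twisted l hl]

theorem const_boost (a : ℝ) : IsTwistedLoop fun _ => toC (boost a) where
  analytic _ _ := differentiableOn_const _
  det_one _ _ := by rw [det_toC, det_boost, Complex.ofReal_one]
  real_coeff _ _ i j := by simp [toC]
  twisted _ _ := sigma_toC_boost a

/-- Inversion of the loop parameter commutes with complex conjugation and with the sign change,
hence preserves reality and twisting. It exchanges plus and minus loops. -/
theorem comp_inv (hγ : IsTwistedLoop γ) : IsTwistedLoop fun l => γ l⁻¹ where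
  analytic i j := (hγ.analytic i j).comp
    (fun _ hl => (differentiableAt_inv hl).differentiableWithinAt) fun _ hl => inv_ne_zero hl
  det_one l hl := hγ.det_one _ (inv_ne_zero hl)
  real_coeff l hl i j := by rw [← map_inv₀]; exact hγ.real_coeff _ (inv_ne_zero hl) i j
  twisted l hl := by rw [inv_neg]; exact hγ.twisted _ (inv_ne_zero hl)

end IsTwistedLoop

theorem IsBirkhoffMP.comp_inv {γ γm lp : ℂ → M2 ℂ} (h : IsBirkhoffMP γ γm lp) :
    IsBirkhoffPM (fun l => γ l⁻¹) (fun l => γm l⁻¹) (fun l => lp l⁻¹) := by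
  obtain ⟨⟨h1, k, hk, hk0, hkl⟩, ⟨h2, m, hm, hml⟩, h3⟩ := h
  refine ⟨⟨h1.comp_inv, k, hk, hk0, fun l hl => ?_⟩, ⟨h2.comp_inv, m, hm, fun l hl => ?_⟩,
    fun l hl => h3 _ (inv_ne_zero hl)⟩
  · exact (hkl _ (inv_ne_zero hl)).trans (by rw [inv_inv])
  · exact hml _ (inv_ne_zero hl)

theorem IsBirkhoffPM.comp_inv {γ γp lm : ℂ → M2 ℂ} (h : IsBirkhoffPM γ γp lm) :
    IsBirkhoffMP (fun l => γ l⁻¹) (fun l => γp l⁻¹) (fun l => lm l⁻¹) := by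
  obtain ⟨⟨h1, k, hk, hk0, hkl⟩, ⟨h2, m, hm, hml⟩, h3⟩ := h
  refine ⟨⟨h1.comp_inv, k, hk, hk0, fun l hl => ?_⟩, ⟨h2.comp_inv, m, hm, fun l hl => ?_⟩,
    fun l hl => h3 _ (inv_ne_zero hl)⟩
  · exact hkl _ (inv_ne_zero hl)
  · exact (hml _ (inv_ne_zero hl)).trans (by rw [inv_inv])

/-- An entire function that is also entire in `l⁻¹` is constant. -/
theorem eq_of_entire_of_entire_inv {f g : ℂ → ℂ} (hf : Differentiable ℂ f)
    (hg : Differentiable ℂ g) (h : ∀ l, l ≠ 0 → f l = g l⁻¹) (l : ℂ) : f l = f 0 := by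
  refine hf.apply_eq_apply_of_bounded ?_ l 0
  obtain ⟨C, hC⟩ := (isCompact_closedBall (0 : ℂ) 1).exists_bound_of_continuousOn
    hf.continuous.continuousOn
  obtain ⟨C', hC'⟩ := (isCompact_closedBall (0 : ℂ) 1).exists_bound_of_continuousOn
    hg.continuous.continuousOn
  refine (Metric.isBounded_closedBall (x := (0 : ℂ)) (r := max C C')).subset ?_
  rintro _ ⟨z, rfl⟩
  rw [mem_closedBall_zero_iff]
  -- Liouville: f is bounded by compactness on the closed unit disc, and outside it by the bound of
  -- g there.
  rcases le_total ‖z‖ 1 with hz | hz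
  · exact (hC z (by simpa using hz)).trans (le_max_left _ _)
  · have hz0 : z ≠ 0 := by rintro rfl; simp at hz; linarith
    rw [h z hz0]
    refine (hC' _ ?_).trans (le_max_right _ _)
    rw [mem_closedBall_zero_iff, norm_inv]
    exact inv_le_one_of_one_le₀ hz

/-- Uniqueness of the Birkhoff decomposition. -/
theorem IsBirkhoffPM.unique {γ γp lm γp' lm' : ℂ → M2 ℂ} (h : IsBirkhoffPM γ γp lm)
    (h' : IsBirkhoffPM γ γp' lm') {l : ℂ} (hl : l ≠ 0) : γp l = γp' l := by
  obtain ⟨⟨ht, a, ha, ha0, hal⟩, ⟨hs, b, hb, hbl⟩, hγ⟩ := h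
  obtain ⟨⟨ht', a', ha', ha0', hal'⟩, ⟨hs', b', hb', hbl'⟩, hγ'⟩ := h'
  have key : ∀ z, z ≠ 0 → (a' z).adjugate * a z = b' z⁻¹ * (b z⁻¹).adjugate := fun z hz => by
    rw [← hal' z hz, ← hal z hz, ← hbl z hz, ← hbl' z hz]
    have h1 := (hγ z hz).symm.trans (hγ' z hz)
    calc (γp' z).adjugate * γp z
        = (γp' z).adjugate * (γp z * lm z) * (lm z).adjugate := by
          simp only [Matrix.mul_assoc]
          rw [mul_adjugate_of_det_one (hs.det_one z hz), Matrix.mul_one]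
      _ = lm' z * (lm z).adjugate := by
          rw [h1, ← Matrix.mul_assoc, adjugate_mul_of_det_one (ht'.det_one z hz), Matrix.one_mul]
  -- The quotient of the plus factors is entire in l and, by `key`, also in l⁻¹. It is therefore
  -- constant, and both factors are 1 at the origin.
  have hW : (a' l).adjugate * a l = 1 := by
    have h0 : (a' 0).adjugate * a 0 = 1 := by simp [ha0, ha0']
    rw [← h0]
    ext i j
    exact eq_of_entire_of_entire_inv
      (differentiable_mul_entries (differentiable_adjugate_entries ha') ha i j)
      (differentiable_mul_entries hb' (differentiable_adjugate_entries hb) i j)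
      (fun z hz => congrFun (congrFun (key z hz) i) j) l
  rw [← hal l hl, ← hal' l hl] at hW
  calc γp l = γp' l * ((γp' l).adjugate * γp l) := by
        rw [← Matrix.mul_assoc, mul_adjugate_of_det_one (ht'.det_one l hl), Matrix.one_mul]
    _ = γp' l := by rw [hW, Matrix.mul_one]

/-! ### Linear differential equations that depend on the loop parameter -/

theorem gronwallBound_zero_self (K : ℝ) : gronwallBound 0 K K 1 = Real.exp K - 1 := by
  rcases eq_or_ne K 0 with rfl | hK
  · simp [gronwallBound]
  · simp [gronwallBound_of_K_ne_0 hK, div_self hK]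

/-- Grönwall for Ψ - 1, which starts at 0 and satisfies |f'| ≤ K|f| + K with K = 2C|l|; the 2 counts
the terms of a matrix product. What matters is that the bound tends to 0 with l. -/
theorem norm_sub_one_le_of_hasDerivAt {Ψ B : ℝ → M2 ℂ} {l : ℂ} {C : ℝ} (hC : 0 ≤ C)
    (hB : ∀ t ∈ Icc (0 : ℝ) 1, ∀ i j, ‖B t i j‖ ≤ C)
    (hΨ : ∀ t ∈ Icc (0 : ℝ) 1, ∀ i j, HasDerivAt (fun s => Ψ s i j) ((Ψ t * (l • B t)) i j) t)
    (h0 : Ψ 0 = 1) (i j : Fin 2) :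
    ‖Ψ 1 i j - (1 : M2 ℂ) i j‖ ≤ Real.exp (2 * C * ‖l‖) - 1 := by
  set f : ℝ → Fin 2 → Fin 2 → ℂ := fun s i j => Ψ s i j - (1 : M2 ℂ) i j with hf
  set f' : ℝ → Fin 2 → Fin 2 → ℂ := fun s i j => (Ψ s * (l • B s)) i j with hf'
  have hd : ∀ t ∈ Icc (0 : ℝ) 1, HasDerivAt f (f' t) t := fun t ht =>
    hasDerivAt_pi.2 fun i => hasDerivAt_pi.2 fun j => (hΨ t ht i j).sub_const _
  have hone : ∀ a b : Fin 2, ‖(1 : M2 ℂ) a b‖ ≤ if a = b then 1 else 0 := fun a b => by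
    rw [Matrix.one_apply]; split_ifs <;> simp
  have hbound : ∀ t ∈ Ico (0 : ℝ) 1, ‖f' t‖ ≤ 2 * C * ‖l‖ * ‖f t‖ + 2 * C * ‖l‖ := by
    intro t ht
    have ht' := Ico_subset_Icc_self ht
    have hn : 0 ≤ 2 * C * ‖l‖ * ‖f t‖ + 2 * C * ‖l‖ := by positivity
    refine (pi_norm_le_iff_of_nonneg hn).2 fun a => (pi_norm_le_iff_of_nonneg hn).2 fun b => ?_
    have hterm : ∀ k, ‖Ψ t a k * (l * B t k b)‖ ≤ (‖f t‖ + ‖(1 : M2 ℂ) a k‖) * (‖l‖ * C) := by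
      intro k
      rw [norm_mul, norm_mul]
      refine mul_le_mul ?_ (mul_le_mul_of_nonneg_left (hB t ht' k b) (norm_nonneg _))
        (by positivity) (by positivity)
      have h1 : ‖f t a k‖ ≤ ‖f t‖ := (norm_le_pi_norm (f t a) k).trans (norm_le_pi_norm (f t) a)
      calc ‖Ψ t a k‖ = ‖f t a k + (1 : M2 ℂ) a k‖ := by simp [hf]
        _ ≤ _ := (norm_add_le _ _).trans (by gcongr)
    -- The true value is 1; the cruder 2 makes both Grönwall constants equal.
    have hsum : ‖(1 : M2 ℂ) a 0‖ + ‖(1 : M2 ℂ) a 1‖ ≤ 2 := by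
      have h0 := hone a 0
      have h1 := hone a 1
      split_ifs at h0 h1 <;> linarith
    have hlC : 0 ≤ ‖l‖ * C := by positivity
    calc ‖f' t a b‖ = ‖Ψ t a 0 * (l * B t 0 b) + Ψ t a 1 * (l * B t 1 b)‖ := by
          simp [hf', Matrix.mul_apply, Fin.sum_univ_two]
      _ ≤ _ := (norm_add_le _ _).trans (add_le_add (hterm 0) (hterm 1))
      _ = (2 * ‖f t‖ + (‖(1 : M2 ℂ) a 0‖ + ‖(1 : M2 ℂ) a 1‖)) * (‖l‖ * C) := by ring
      _ ≤ (2 * ‖f t‖ + 2) * (‖l‖ * C) := by gcongr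
      _ = _ := by ring
  have hg := norm_le_gronwallBound_of_norm_deriv_right_le (f := f) (f' := f') (δ := 0)
    (K := 2 * C * ‖l‖) (ε := 2 * C * ‖l‖) (a := 0) (b := 1)
    (fun t ht => (hd t ht).continuousAt.continuousWithinAt)
    (fun t ht => (hd t (Ico_subset_Icc_self ht)).hasDerivWithinAt)
    (by rw [show f 0 = 0 by ext i j; simp [hf, h0], norm_zero]) hbound 1
    (right_mem_Icc.2 zero_le_one)
  rw [sub_zero, gronwallBound_zero_self] at hg
  exact ((norm_le_pi_norm (f 1 i) j).trans (norm_le_pi_norm (f 1) i)).trans hg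

/-- A function on the punctured plane with a limit at `0` extends to an entire function. -/
theorem exists_entire_extension {g : ℂ → ℂ} {v : ℂ} (hg : DifferentiableOn ℂ g {0}ᶜ)
    (hv : Tendsto g (𝓝[≠] 0) (𝓝 v)) : Differentiable ℂ (Function.update g 0 v) := by
  rw [← differentiableOn_univ, ← Complex.differentiableOn_compl_singleton_and_continuousAt_iff
    (c := (0 : ℂ)) univ_mem]
  refine ⟨?_, continuousAt_update_same.2 hv⟩
  rw [← compl_eq_univ_sdiff]
  exact hg.congr fun z hz => Function.update_of_ne hz _ _

/-- Analyticity off the origin is given, so only the limit 1 at l = 0 has to be shown. It comes from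
the Grönwall bound, and the singularity is then removable. -/
theorem exists_entire_of_hasDerivAt {Ψ : ℝ → ℂ → M2 ℂ} {B : ℝ → M2 ℂ}
    (hB : ∀ i j, ContinuousOn (fun t => B t i j) (Icc 0 1))
    (hΨ : ∀ t ∈ Icc (0 : ℝ) 1, ∀ l, l ≠ 0 → ∀ i j,
      HasDerivAt (fun s => Ψ s l i j) ((Ψ t l * (l • B t)) i j) t)
    (h0 : ∀ l, l ≠ 0 → Ψ 0 l = 1)
    (han : ∀ i j, DifferentiableOn ℂ (fun l => Ψ 1 l i j) {0}ᶜ) :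
    ∃ h : ℂ → M2 ℂ, (∀ i j, Differentiable ℂ (fun l => h l i j)) ∧ h 0 = 1 ∧
      ∀ l, l ≠ 0 → Ψ 1 l = h l := by
  obtain ⟨C, hC⟩ : ∃ C, ∀ t ∈ Icc (0 : ℝ) 1, ‖(fun i j => B t i j : Fin 2 → Fin 2 → ℂ)‖ ≤ C :=
    isCompact_Icc.exists_bound_of_continuousOn
      (continuousOn_pi.2 fun i => continuousOn_pi.2 fun j => hB i j)
  have hC0 : 0 ≤ C := (norm_nonneg _).trans (hC 0 (left_mem_Icc.2 zero_le_one))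
  have hBC : ∀ t ∈ Icc (0 : ℝ) 1, ∀ i j, ‖B t i j‖ ≤ C := fun t ht i j =>
    ((norm_le_pi_norm (fun j => B t i j) j).trans
      (norm_le_pi_norm (fun i j => B t i j : Fin 2 → Fin 2 → ℂ) i)).trans (hC t ht)
  have hlim : ∀ i j, Tendsto (fun l => Ψ 1 l i j) (𝓝[≠] 0) (𝓝 ((1 : M2 ℂ) i j)) := by
    intro i j
    rw [tendsto_iff_norm_sub_tendsto_zero]
    have hb : Tendsto (fun l : ℂ => Real.exp (2 * C * ‖l‖) - 1) (𝓝[≠] 0) (𝓝 0) := by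
      have : Continuous fun l : ℂ => Real.exp (2 * C * ‖l‖) - 1 := by fun_prop
      have h := this.tendsto 0
      simp only [norm_zero, mul_zero, Real.exp_zero, sub_self] at h
      exact h.mono_left nhdsWithin_le_nhds
    refine squeeze_zero' (Eventually.of_forall fun _ => norm_nonneg _) ?_ hb
    filter_upwards [self_mem_nhdsWithin] with l hl
    exact norm_sub_one_le_of_hasDerivAt (Ψ := fun s => Ψ s l) hC0 hBC
      (fun t ht => hΨ t ht l hl) (h0 l hl) i j
  refine ⟨fun l => Matrix.of fun i j =>
    Function.update (fun l => Ψ 1 l i j) 0 ((1 : M2 ℂ) i j) l, fun i j => ?_, ?_, fun l hl => ?_⟩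
  · exact exists_entire_extension (han i j) (hlim i j)
  · ext i j; simp
  · ext i j; simp [Function.update_of_ne hl]

/-- The gauge `boost (c 0 - c t)` is 1 at t = 0 and cancels the diagonal term, leaving an equation
whose coefficient is a multiple of l. -/
theorem exists_entire_of_hasDerivAt_diagGen {X : ℝ → ℂ → M2 ℂ} {c c' : ℝ → ℝ} {M : ℝ → M2 ℝ}
    (hM : ∀ i j, ContinuousOn (fun t => M t i j) (Icc 0 1))
    (hc : ∀ t ∈ Icc (0 : ℝ) 1, HasDerivAt c (c' t) t)
    (hX : ∀ t ∈ Icc (0 : ℝ) 1, ∀ l, l ≠ 0 → ∀ i j,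
      HasDerivAt (fun s => X s l i j)
        ((X t l * (toC (diagGen (c' t)) + l • toC (M t))) i j) t)
    (h0 : ∀ l, l ≠ 0 → X 0 l = 1)
    (han : ∀ i j, DifferentiableOn ℂ (fun l => X 1 l i j) {0}ᶜ) :
    ∃ h : ℂ → M2 ℂ, (∀ i j, Differentiable ℂ (fun l => h l i j)) ∧ h 0 = 1 ∧
      ∀ l, l ≠ 0 → X 1 l * toC (boost (c 0 - c 1)) = h l := by
  have hcc : ContinuousOn c (Icc 0 1) := fun t ht => (hc t ht).continuousAt.continuousWithinAt
  have hbc : ∀ {b : ℝ → ℝ}, ContinuousOn b (Icc 0 1) → ∀ i j,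
      ContinuousOn (fun t => boost (b t) i j) (Icc 0 1) := by
    intro b hb i j
    fin_cases i <;> fin_cases j <;> simp only [boost] <;> simp <;> fun_prop
  have hmul : ∀ {Y Z : ℝ → M2 ℝ}, (∀ i j, ContinuousOn (fun t => Y t i j) (Icc 0 1)) →
      (∀ i j, ContinuousOn (fun t => Z t i j) (Icc 0 1)) → ∀ i j,
      ContinuousOn (fun t => (Y t * Z t) i j) (Icc 0 1) := by
    intro Y Z hY hZ i j
    simp only [Matrix.mul_apply, Fin.sum_univ_two]
    exact ((hY i 0).mul (hZ 0 j)).add ((hY i 1).mul (hZ 1 j))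
  refine exists_entire_of_hasDerivAt (Ψ := fun t l => X t l * toC (boost (c 0 - c t)))
    (B := fun t => toC (boost (-(c 0 - c t)) * M t * boost (c 0 - c t))) (fun i j => ?_)
    (fun t ht l hl => hasDerivAt_mul_boost (hX t ht l hl) ((hc t ht).const_sub (c 0)))
    (fun l hl => by simp [h0 l hl, boost_zero, toC_one])
    (differentiableOn_mul_entries han fun _ _ => differentiableOn_const _)
  exact Complex.continuous_ofReal.comp_continuousOn
    (hmul (hmul (hbc (by fun_prop)) hM) (hbc (by fun_prop)) i j)

/-! ### The domains of the decompositions -/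

theorem forall_mem_uIcc_zero {a : ℝ} {P : ℝ → Prop} :
    (∀ t ∈ uIcc 0 a, P t) ↔ ∀ s ∈ Icc (0 : ℝ) 1, P (s * a) := by
  rw [← segment_eq_uIcc, segment_eq_image, forall_mem_image]
  simp

/-- Both segments are parametrized by the fixed compact interval [0, 1], so that openness follows
from the tube lemma. -/
theorem mem_hookX {D : Set (ℝ × ℝ)} {p : ℝ × ℝ} : p ∈ hookX D ↔
    ∀ s ∈ Icc (0 : ℝ) 1, (s * p.1, (0 : ℝ)) ∈ D ∧ (p.1, s * p.2) ∈ D := by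
  rw [hookX, mem_ofPred_eq, forall_mem_uIcc_zero, forall_mem_uIcc_zero]
  exact ⟨fun h s hs => ⟨h.1 s hs, h.2 s hs⟩,
    fun h => ⟨fun s hs => (h s hs).1, fun s hs => (h s hs).2⟩⟩

theorem isOpen_hookX {D : Set (ℝ × ℝ)} (hD : IsOpen D) : IsOpen (hookX D) := by
  rw [isOpen_iff_eventually]
  intro p hp
  have h1 : IsOpen {z : (ℝ × ℝ) × ℝ | (z.2 * z.1.1, (0 : ℝ)) ∈ D ∧ (z.1.1, z.2 * z.1.2) ∈ D} :=
    (hD.preimage (f := fun z : (ℝ × ℝ) × ℝ => (z.2 * z.1.1, (0 : ℝ))) (by fun_prop)).inter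
      (hD.preimage (f := fun z : (ℝ × ℝ) × ℝ => (z.1.1, z.2 * z.1.2)) (by fun_prop))
  have h2 := (isCompact_Icc (a := (0 : ℝ)) (b := 1)).eventually_forall_of_forall_eventually
    (x₀ := p) (P := fun q s => (s * q.1, (0 : ℝ)) ∈ D ∧ (q.1, s * q.2) ∈ D)
    fun s hs => h1.mem_nhds (mem_hookX.1 hp s hs)
  exact h2.mono fun q hq => mem_hookX.2 hq

theorem zero_mem_hookX {D : Set (ℝ × ℝ)} (h0 : (0 : ℝ × ℝ) ∈ D) : (0 : ℝ × ℝ) ∈ hookX D :=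
  mem_hookX.2 fun s _ => by simpa [← Prod.zero_eq_mk] using h0

theorem hookX_subset (D : Set (ℝ × ℝ)) : hookX D ⊆ D := fun p hp => hp.2 p.2 right_mem_uIcc

theorem mk_zero_mem_of_mem_hookX {D : Set (ℝ × ℝ)} {p : ℝ × ℝ} (hp : p ∈ hookX D) :
    (p.1, (0 : ℝ)) ∈ D := hp.1 p.1 right_mem_uIcc

/-! ### The normalized potential -/

theorem HasMCForm.hasDerivAt_x {X : ℝ × ℝ → M2 ℂ} {U V : M2 ℂ} {p : ℝ × ℝ}
    (h : HasMCForm X U V p) (i j : Fin 2) :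
    HasDerivAt (fun t => X (t, p.2) i j) ((X p * U) i j) p.1 := by
  have := HasFDerivAt.comp_hasDerivAt (x := p.1) (f := fun t : ℝ => (t, p.2))
    (l := fun q => X q i j) (h i j) (hasDerivAt_prodMk_left p)
  exact this.congr_deriv (by simp)

theorem HasMCForm.hasDerivAt_y {X : ℝ × ℝ → M2 ℂ} {U V : M2 ℂ} {p : ℝ × ℝ}
    (h : HasMCForm X U V p) (i j : Fin 2) :
    HasDerivAt (fun t => X (p.1, t) i j) ((X p * V) i j) p.2 := by
  have := HasFDerivAt.comp_hasDerivAt (x := p.2) (f := fun t : ℝ => (p.1, t))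
    (l := fun q => X q i j) (h i j) (hasDerivAt_prodMk_right p)
  exact this.congr_deriv (by simp)

theorem HasMCForm.swap {X : ℝ × ℝ → M2 ℂ} {U V : M2 ℂ} {p : ℝ × ℝ}
    (h : HasMCForm X U V p.swap) : HasMCForm (fun q => X q.swap) V U p := by
  intro i j
  have := (h i j).comp p (ContinuousLinearEquiv.prodComm ℝ ℝ ℝ).toContinuousLinearMap.hasFDerivAt
  refine this.congr_fderiv ?_
  ext <;> simp

/-- The symmetry (x, y, λ) ↦ (y, x, λ⁻¹) exchanges the two kinds of splitting and of potential. -/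
theorem IsNormalizedPotentialX.swap {Ω : Set (ℝ × ℝ)} {Φ : ℝ × ℝ → ℂ → M2 ℂ} {ξ : ℝ → ℂ → M2 ℂ}
    (h : IsNormalizedPotentialX (Prod.swap ⁻¹' Ω) (fun p l => Φ p.swap l⁻¹) ξ) :
    IsNormalizedPotentialY Ω Φ (fun y l => ξ y l⁻¹) where
  isOpen := by simpa [← preimage_comp] using h.isOpen.preimage continuous_swap
  zero_mem := h.zero_mem
  splits p hp := by
    obtain ⟨γp, lm, hb⟩ := h.splits p.swap (by simpa using hp)
    exact ⟨_, _, by simpa using hb.comp_inv⟩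
  form Φm Lp hb p hp l hl := by
    have h1 := h.form (fun p l => Φm p.swap l⁻¹) (fun p l => Lp p.swap l⁻¹)
      (fun q hq => (hb q.swap hq).comp_inv) p.swap (by simpa using hp) l⁻¹ (inv_ne_zero hl)
    simpa using h1.swap

section Potential

variable {D : Set (ℝ × ℝ)} {Φ : ℝ × ℝ → ℂ → M2 ℂ} {c cx cy : ℝ × ℝ → ℝ}
  {M M' : ℝ × ℝ → M2 ℝ} {p : ℝ × ℝ}

/-- The factor `Φ₊` of the Birkhoff decomposition. -/
def plusFactor (Φ : ℝ × ℝ → ℂ → M2 ℂ) (c : ℝ × ℝ → ℝ) (p : ℝ × ℝ) (l : ℂ) : M2 ℂ :=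
  Φ (p.1, 0) l * toC (boost (c 0 - c (p.1, 0)))

/-- The factor `L₋` of the Birkhoff decomposition. -/
def minusFactor (Φ : ℝ × ℝ → ℂ → M2 ℂ) (c : ℝ × ℝ → ℝ) (p : ℝ × ℝ) (l : ℂ) : M2 ℂ :=
  toC (boost (c (p.1, 0) - c 0)) * ((Φ (p.1, 0) l).adjugate * Φ p l)

/-- The first leg of the hook carries only the power λ besides the diagonal term, the second only
λ⁻¹. Each leg gives one factor, and the boosts cancel in the product. -/
theorem isBirkhoffPM_factors
    (hcx : ∀ p ∈ D, HasDerivAt (fun t => c (t, p.2)) (cx p) p.1)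
    (hcy : ∀ p ∈ D, HasDerivAt (fun t => c (p.1, t)) (cy p) p.2)
    (hM : ∀ i j, ContinuousOn (fun p => M p i j) D)
    (hM' : ∀ i j, ContinuousOn (fun p => M' p i j) D)
    (hloop : ∀ p ∈ D, IsTwistedLoop (Φ p)) (hbase : ∀ l, l ≠ 0 → Φ 0 l = 1)
    (hform : ∀ p ∈ D, ∀ l, l ≠ 0 → HasMCForm (fun q => Φ q l)
      (toC (diagGen (cx p)) + l • toC (M p)) (toC (diagGen (-cy p)) + l⁻¹ • toC (M' p)) p)
    (hp : p ∈ hookX D) : IsBirkhoffPM (Φ p) (plusFactor Φ c p) (minusFactor Φ c p) := by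
  have hpD := hookX_subset D hp
  have hp0 := mk_zero_mem_of_mem_hookX hp
  have hpath := mem_hookX.1 hp
  refine ⟨⟨(hloop _ hp0).mul (IsTwistedLoop.const_boost _), ?_⟩,
    ⟨(IsTwistedLoop.const_boost _).mul ((hloop _ hp0).adjugate.mul (hloop _ hpD)), ?_⟩,
    fun l hl => ?_⟩
  · have h := exists_entire_of_hasDerivAt_diagGen (X := fun t => Φ (t * p.1, 0))
      (c := fun t => c (t * p.1, 0)) (c' := fun t => cx (t * p.1, 0) * p.1)
      (M := fun t => p.1 • M (t * p.1, 0)) (fun i j => ?_) (fun t ht => ?_)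
      (fun t ht l hl i j => ?_) (fun l hl => ?_) (fun i j => ?_)
    · simpa [plusFactor, ← Prod.zero_eq_mk] using h
    · exact ((hM i j).comp (f := fun t : ℝ => (t * p.1, (0 : ℝ))) (by fun_prop)
        fun t ht => (hpath t ht).1).const_smul p.1
    · exact (hcx _ (hpath t ht).1).comp t (hasDerivAt_mul_const p.1)
    · have h := ((hform _ (hpath t ht).1 l hl).hasDerivAt_x i j).scomp t
        (hasDerivAt_mul_const p.1)
      refine h.congr_deriv ?_
      rw [← smul_mul_toC_diagGen_add, Matrix.smul_apply]
    · simpa [← Prod.zero_eq_mk] using hbase l hl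
    · simpa using (hloop _ hp0).analytic i j
  -- Left translation by the fixed matrix Φ(x, 0)⁻¹ does not change the logarithmic derivative and
  -- gives initial value 1. Evaluation at l⁻¹ turns λ⁻¹ into a positive power; the sign of c matches
  -- the diagonal -c_y.
  · have hex := exists_entire_of_hasDerivAt_diagGen
      (X := fun t l => (Φ (p.1, 0) l⁻¹).adjugate * Φ (p.1, t * p.2) l⁻¹)
      (c := fun t => -c (p.1, t * p.2)) (c' := fun t => -cy (p.1, t * p.2) * p.2)
      (M := fun t => p.2 • M' (p.1, t * p.2)) (fun i j => ?_) (fun t ht => ?_)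
      (fun t ht l hl i j => ?_) (fun l hl => ?_) (fun i j => ?_)
    · obtain ⟨h, hh, -, hl⟩ := hex
      -- The right boost undoes the gauge; the left one is the compensating factor in `minusFactor`.
      -- No normalization at l = 0 is required of L₋.
      refine ⟨fun l => toC (boost (c (p.1, 0) - c 0)) * (h l * toC (boost (c (p.1, 0) - c p))),
        differentiable_mul_entries (fun _ _ => differentiable_const _)
          (differentiable_mul_entries hh fun _ _ => differentiable_const _), fun l hl0 => ?_⟩
      beta_reduce
      rw [← hl _ (inv_ne_zero hl0), Matrix.mul_assoc, ← toC_mul]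
      have : boost (-c (p.1, 0 * p.2) - -c (p.1, 1 * p.2)) * boost (c (p.1, 0) - c p) = 1 := by
        rw [boost_mul, zero_mul, one_mul, Prod.mk.eta,
          show -c (p.1, 0) - -c p + (c (p.1, 0) - c p) = 0 by ring, boost_zero]
      rw [this, toC_one, Matrix.mul_one, inv_inv, one_mul, Prod.mk.eta, minusFactor]
    · exact ((hM' i j).comp (f := fun t : ℝ => (p.1, t * p.2)) (by fun_prop)
        fun t ht => (hpath t ht).2).const_smul p.2
    · refine (((hcy _ (hpath t ht).2).comp t (hasDerivAt_mul_const p.2)).neg).congr_deriv ?_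
      rw [neg_mul]
    · have hd : ∀ i j, HasDerivAt (fun s => Φ (p.1, s * p.2) l⁻¹ i j)
          ((Φ (p.1, t * p.2) l⁻¹ * (toC (diagGen (-cy (p.1, t * p.2) * p.2))
            + l • toC (p.2 • M' (p.1, t * p.2)))) i j) t := fun i j => by
        have h := ((hform _ (hpath t ht).2 _ (inv_ne_zero hl)).hasDerivAt_y i j).scomp t
          (hasDerivAt_mul_const p.2)
        refine h.congr_deriv ?_
        rw [← smul_mul_toC_diagGen_add, Matrix.smul_apply, inv_inv]
      refine (hasDerivAt_mul_entries (X := fun _ => (Φ (p.1, 0) l⁻¹).adjugate) (X' := 0)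
        (fun i j => hasDerivAt_const _ _) hd i j).congr_deriv ?_
      rw [Matrix.zero_mul, zero_add, Matrix.mul_assoc]
    · simpa using adjugate_mul_of_det_one ((hloop _ hp0).det_one _ (inv_ne_zero hl))
    · simpa using (((hloop _ hp0).adjugate.mul (hloop _ hpD)).comp_inv).analytic i j
  · have h1 : toC (boost (c 0 - c (p.1, 0))) * toC (boost (c (p.1, 0) - c 0)) = 1 := by
      rw [← toC_mul, ← neg_sub (c 0), boost_mul_neg, toC_one]
    rw [plusFactor, minusFactor, Matrix.mul_assoc, ← Matrix.mul_assoc (toC _), h1, Matrix.one_mul,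
      ← Matrix.mul_assoc, mul_adjugate_of_det_one ((hloop _ hp0).det_one l hl), Matrix.one_mul]

/-- The factor depends on x alone, so its differential is a pullback along the first projection and
has no dy-part. -/
theorem hasMCForm_plusFactor
    (hcx : ∀ p ∈ D, HasDerivAt (fun t => c (t, p.2)) (cx p) p.1)
    (hform : ∀ p ∈ D, ∀ l, l ≠ 0 → ∃ V, HasMCForm (fun q => Φ q l)
      (toC (diagGen (cx p)) + l • toC (M p)) V p)
    (hp : (p.1, (0 : ℝ)) ∈ D) {l : ℂ} (hl : l ≠ 0) :
    HasMCForm (fun q => plusFactor Φ c q l)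
      (l • toC (boost (c (p.1, 0) - c 0) * M (p.1, 0) * boost (c 0 - c (p.1, 0)))) 0 p := by
  intro i j
  obtain ⟨V, hV⟩ := hform _ hp l hl
  have h := (hasDerivAt_mul_boost (fun i j => hV.hasDerivAt_x i j)
    ((hcx _ hp).const_sub (c 0)) i j).hasFDerivAt.comp p hasFDerivAt_fst
  rw [neg_sub] at h
  refine h.congr_fderiv ?_
  ext <;> simp [plusFactor]

/-- The normalized potential of a map into the twisted loops whose Maurer-Cartan form has the
diagonal part `c_x dx - c_y dy`. -/
theorem isNormalizedPotentialX (hD : IsOpen D) (h0 : (0 : ℝ × ℝ) ∈ D)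
    (hcx : ∀ p ∈ D, HasDerivAt (fun t => c (t, p.2)) (cx p) p.1)
    (hcy : ∀ p ∈ D, HasDerivAt (fun t => c (p.1, t)) (cy p) p.2)
    (hM : ∀ i j, ContinuousOn (fun p => M p i j) D)
    (hM' : ∀ i j, ContinuousOn (fun p => M' p i j) D)
    (hloop : ∀ p ∈ D, IsTwistedLoop (Φ p)) (hbase : ∀ l, l ≠ 0 → Φ 0 l = 1)
    (hform : ∀ p ∈ D, ∀ l, l ≠ 0 → HasMCForm (fun q => Φ q l)
      (toC (diagGen (cx p)) + l • toC (M p)) (toC (diagGen (-cy p)) + l⁻¹ • toC (M' p)) p) :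
    IsNormalizedPotentialX (hookX D) Φ fun x l =>
      l • toC (boost (c (x, 0) - c 0) * M (x, 0) * boost (c 0 - c (x, 0))) where
  isOpen := isOpen_hookX hD
  zero_mem := zero_mem_hookX h0
  splits p hp := ⟨_, _, isBirkhoffPM_factors hcx hcy hM hM' hloop hbase hform hp⟩
  form Φp Lm hb p hp l hl := by
    -- Uniqueness identifies any pointwise choice of decompositions with the explicit one, so no
    -- regularity of the choice need be assumed.
    have heq : ∀ q ∈ hookX D, Φp q l = plusFactor Φ c q l := fun q hq =>
      (hb q hq).unique (isBirkhoffPM_factors hcx hcy hM hM' hloop hbase hform hq) hl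
    have h := hasMCForm_plusFactor (M := M) hcx (fun q hq l hl => ⟨_, hform q hq l hl⟩)
      (mk_zero_mem_of_mem_hookX hp) hl
    intro i j
    beta_reduce
    rw [heq p hp]
    refine (h i j).congr_of_eventuallyEq ?_
    filter_upwards [(isOpen_hookX hD).mem_nhds hp] with q hq
    rw [heq q hq]

end Potential

/-! ### The potentials of the surface -/

theorem IsNormalizedPotentialX.congr {Ω : Set (ℝ × ℝ)} {Φ : ℝ × ℝ → ℂ → M2 ℂ}
    {ξ ξ' : ℝ → ℂ → M2 ℂ} (h : IsNormalizedPotentialX Ω Φ ξ)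
    (hξ : ∀ p ∈ Ω, ∀ l, ξ p.1 l = ξ' p.1 l) : IsNormalizedPotentialX Ω Φ ξ' where
  isOpen := h.isOpen
  zero_mem := h.zero_mem
  splits := h.splits
  form Φp Lm hb p hp l hl := by
    rw [← hξ p hp]
    exact h.form Φp Lm hb p hp l hl

theorem boost_conj_offDiag (d b c : ℝ) : boost d * !![0, b; c, 0] * boost (-d)
    = !![0, Real.exp (2 * d) * b; Real.exp (-(2 * d)) * c, 0] := by
  have h1 : Real.exp (2 * d) = Real.exp d * Real.exp d := by rw [← Real.exp_add, two_mul]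
  have h2 : Real.exp (-(2 * d)) = Real.exp (-d) * Real.exp (-d) := by
    rw [← Real.exp_add]; ring_nf
  rw [h1, h2]
  ext i j
  fin_cases i <;> fin_cases j <;> simp [boost, Matrix.mul_apply, Fin.sum_univ_two] <;> ring

/-- The off-diagonal part. -/
def offDiag (U : M2 ℝ) : M2 ℝ := !![0, U 0 1; U 1 0, 0]

theorem continuousOn_offDiag {D : Set (ℝ × ℝ)} {U : ℝ × ℝ → M2 ℝ} (hU : SmoothOn D U)
    (i j : Fin 2) : ContinuousOn (fun p => offDiag (U p) i j) D := by
  fin_cases i <;> fin_cases j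
  · simpa [offDiag] using continuousOn_const
  · simpa [offDiag] using (hU 0 1).continuousOn
  · simpa [offDiag] using (hU 1 0).continuousOn
  · simpa [offDiag] using continuousOn_const

section Surface

variable {D : Set (ℝ × ℝ)} {φ N : ℝ × ℝ → M2 ℝ} {ω : ℝ × ℝ → ℝ} {H : ℝ}
  {A : M2 ℝ →ₗ[ℝ] M2 ℝ} {F : ℝ × ℝ → M2 ℝ} {Φ : ℝ × ℝ → ℂ → M2 ℂ} {f : ℝ → ℝ}

theorem IsExtendedFraming.form_diagGen (hφ : IsTimelikeCMCSurface D φ N ω H) (hD : IsOpen D)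
    (hA : IsLorentzIsometry A) (hF : IsCoordinateFrame D φ N ω A F)
    (hΦ : IsExtendedFraming D F Φ) {p : ℝ × ℝ} (hp : p ∈ D) {l : ℂ} (hl : l ≠ 0) :
    HasMCForm (fun q => Φ q l)
      (toC (diagGen (fderiv ℝ ω p (1, 0) / 4)) + l • toC (offDiag ((F p)⁻¹ * pdx F p)))
      (toC (diagGen (-(fderiv ℝ ω p (0, 1) / 4))) + l⁻¹ • toC (offDiag ((F p)⁻¹ * pdy F p)))
      p := by
  have h := hΦ.form p hp l hl
  have fe := frameEquations hφ hD hA hF hp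
  rwa [kPart_toC (hF.trace_inv_mul_pdx hD hp), kPart_toC (hF.trace_inv_mul_pdy hD hp),
    mPart_toC, mPart_toC, fe.u00, fe.v00] at h

theorem isNormalizedPotentialX_of_extendedFraming (hD : IsOpen D) (h0 : (0 : ℝ × ℝ) ∈ D)
    (hφ : IsTimelikeCMCSurface D φ N ω H) (hA : IsLorentzIsometry A)
    (hF : IsCoordinateFrame D φ N ω A F) (hΦ : IsExtendedFraming D F Φ)
    (hf : ∀ x, f x = Real.exp (ω (x, 0) - ω (0, 0) / 2)) :
    IsNormalizedPotentialX (hookX D) Φ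
      fun x l => l • toC !![0, -(H / 2) * f x; hopfQ φ N (x, 0) / f x, 0] := by
  refine (isNormalizedPotentialX (c := fun p => ω p / 4) hD h0
    (fun p hp => (hφ.hasDerivAt_omega_x hD hp).div_const 4)
    (fun p hp => (hφ.hasDerivAt_omega_y hD hp).div_const 4)
    (continuousOn_offDiag (hF.smoothOn_inv_mul (hF.smooth.pdx hD)))
    (continuousOn_offDiag (hF.smoothOn_inv_mul (hF.smooth.pdy hD))) hΦ.loop hΦ.base
    fun p hp l hl => hΦ.form_diagGen hφ hD hA hF hp hl).congr fun p hp l => ?_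
  have fe := frameEquations hφ hD hA hF (mk_zero_mem_of_mem_hookX hp)
  -- Conjugation by the boost contributes e^{(ω(x,0) - ω(0,0))/2} and the frame entry e^{ω(x,0)/2};
  -- their product is f.
  have hfe : f p.1 = Real.exp (2 * (ω (p.1, 0) / 4 - ω 0 / 4)) * halfExp ω (p.1, 0) := by
    rw [hf, halfExp, ← Real.exp_add, Prod.zero_eq_mk]; ring_nf
  have he := (halfExp_pos ω (p.1, 0)).ne'
  rw [← neg_sub (ω (p.1, 0) / 4), offDiag, boost_conj_offDiag, fe.u01, ← fe.u10, hfe,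
    Real.exp_neg]
  congr 5
  · ring_nf
  · field_simp

theorem isNormalizedPotentialY_of_extendedFraming (hD : IsOpen D) (h0 : (0 : ℝ × ℝ) ∈ D)
    (hφ : IsTimelikeCMCSurface D φ N ω H) (hA : IsLorentzIsometry A)
    (hF : IsCoordinateFrame D φ N ω A F) (hΦ : IsExtendedFraming D F Φ)
    (hf : ∀ y, f y = Real.exp (ω (0, y) - ω (0, 0) / 2)) :
    IsNormalizedPotentialY (hookY D) Φ
      fun y l => l⁻¹ • toC !![0, -hopfR φ N (0, y) / f y; H / 2 * f y, 0] := by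
  have hcont : ∀ {M : ℝ × ℝ → M2 ℝ}, (∀ i j, ContinuousOn (fun p => M p i j) D) →
      ∀ i j, ContinuousOn (fun p : ℝ × ℝ => M p.swap i j) (Prod.swap ⁻¹' D) := fun h i j =>
    (h i j).comp continuous_swap.continuousOn fun _ hp => hp
  refine IsNormalizedPotentialX.swap (ξ := fun y l =>
    l • toC !![0, -hopfR φ N (0, y) / f y; H / 2 * f y, 0]) ?_
  -- After the exchange the leading diagonal entry is -ω_y/4, hence the primitive -ω/4.
  refine (isNormalizedPotentialX (D := Prod.swap ⁻¹' D) (c := fun p => -(ω p.swap / 4))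
    (hD.preimage continuous_swap) h0
    (fun p hp => ((hφ.hasDerivAt_omega_y hD (p := p.swap) hp).div_const 4).neg)
    (fun p hp => ((hφ.hasDerivAt_omega_x hD (p := p.swap) hp).div_const 4).neg)
    (hcont (continuousOn_offDiag (hF.smoothOn_inv_mul (hF.smooth.pdy hD))))
    (hcont (continuousOn_offDiag (hF.smoothOn_inv_mul (hF.smooth.pdx hD))))
    (fun p hp => (hΦ.loop _ hp).comp_inv) (fun l hl => hΦ.base _ (inv_ne_zero hl))
    fun p hp l hl => ?_).congr fun p hp l => ?_
  · have h := (hΦ.form_diagGen hφ hD hA hF (p := p.swap) hp (inv_ne_zero hl)).swap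
    simpa using h
  · have hp0 : ((0 : ℝ), p.1) ∈ D := mk_zero_mem_of_mem_hookX hp
    have fe := frameEquations hφ hD hA hF hp0
    have hfe : f p.1 = Real.exp (2 * (ω (0, p.1) / 4 - ω 0 / 4)) * halfExp ω (0, p.1) := by
      rw [hf, halfExp, ← Real.exp_add, Prod.zero_eq_mk]; ring_nf
    have he := (halfExp_pos ω (0, p.1)).ne'
    have hd : -(ω (0, p.1) / 4) - -(ω 0 / 4) = -(ω (0, p.1) / 4 - ω 0 / 4) := by ring
    have hd' : -(ω 0 / 4) - -(ω (0, p.1) / 4) = - -(ω (0, p.1) / 4 - ω 0 / 4) := by ring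
    rw [Prod.swap_prod_mk, Prod.swap_zero, hd, hd', offDiag, boost_conj_offDiag, fe.v10, ← fe.v01,
      hfe, mul_neg, neg_neg, Real.exp_neg]
    congr 5
    · field_simp
    · ring_nf

end Surface

end TimelikeCMC

end

theorem theorem5p2 (D : Set (ℝ × ℝ)) (hD : IsOpen D) (h0 : (0 : ℝ × ℝ) ∈ D)
    (φ N : ℝ × ℝ → TimelikeCMC.M2 ℝ) (ω : ℝ × ℝ → ℝ) (H : ℝ)
    (hφ : TimelikeCMC.IsTimelikeCMCSurface D φ N ω H)
    (A : TimelikeCMC.M2 ℝ →ₗ[ℝ] TimelikeCMC.M2 ℝ) (hA : TimelikeCMC.IsLorentzIsometry A)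
    (F : ℝ × ℝ → TimelikeCMC.M2 ℝ) (hF : TimelikeCMC.IsCoordinateFrame D φ N ω A F)
    (Φ : ℝ × ℝ → ℂ → TimelikeCMC.M2 ℂ) (hΦ : TimelikeCMC.IsExtendedFraming D F Φ)
    (Q R f g : ℝ → ℝ)
    (hQ : ∀ x, Q x = TimelikeCMC.hopfQ φ N (x, 0))
    (hR : ∀ y, R y = TimelikeCMC.hopfR φ N (0, y))
    (hf : ∀ x, f x = Real.exp (ω (x, 0) - ω (0, 0) / 2))
    (hg : ∀ y, g y = Real.exp (ω (0, y) - ω (0, 0) / 2)) :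
    (∀ p ∈ TimelikeCMC.hookX D, TimelikeCMC.hopfQ φ N p = Q p.1) ∧
    (∀ p ∈ TimelikeCMC.hookY D, TimelikeCMC.hopfR φ N p = R p.2) ∧
    TimelikeCMC.IsNormalizedPotentialX (TimelikeCMC.hookX D) Φ
      (fun x l => l • TimelikeCMC.toC !![0, -(H / 2) * f x; Q x / f x, 0]) ∧
    TimelikeCMC.IsNormalizedPotentialY (TimelikeCMC.hookY D) Φ
      (fun y l => l⁻¹ • TimelikeCMC.toC !![0, -R y / g y; (H / 2) * g y, 0]) := by

  obtain rfl : Q = fun x => TimelikeCMC.hopfQ φ N (x, 0) := funext hQ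
  obtain rfl : R = fun y => TimelikeCMC.hopfR φ N (0, y) := funext hR
  refine ⟨fun p hp => ?_, fun p hp => ?_,
    TimelikeCMC.isNormalizedPotentialX_of_extendedFraming hD h0 hφ hA hF hΦ hf,
    TimelikeCMC.isNormalizedPotentialY_of_extendedFraming hD h0 hφ hA hF hΦ hg⟩
  -- Codazzi is integrated along the second leg of the hook.
  · exact TimelikeCMC.eq_of_hasDerivAt_zero (g := fun t => TimelikeCMC.hopfQ φ N (p.1, t))
      fun s hs => TimelikeCMC.hasDerivAt_hopfQ hφ hD hA hF (p := (p.1, s)) (hp.2 s hs)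
  · exact TimelikeCMC.eq_of_hasDerivAt_zero (g := fun t => TimelikeCMC.hopfR φ N (t, p.2))
      fun t ht => TimelikeCMC.hasDerivAt_hopfR hφ hD hA hF (p := (t, p.2)) (hp.2 t ht)
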